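/- Let $s\ge 1$ and $N=2s+4$. Write $N\times N$ matrices in blocks $2,2s,2$. Let $\eta$ be the symmetric matrix with $\eta_{1,N}=\eta_{2,N-1}=\eta_{N-1,2}=\eta_{N,1}=1$, the unit matrix in the middle $2s\times 2s$ block and zeros elsewhere, and let $U=\mathrm{SO}(2,2+2s)$ denote the identity component of $\{g\in \mathrm{SL}(N,\mathbb R): g^T\eta g=\eta\}$. Let $\Omega$ be the orthogonal matrix whose rows are $e_3^T,\dots,e_{2s+2}^T$, $\tfrac{1}{\sqrt2}(e_1+e_N)^T$, $\tfrac1{\sqrt2}(e_2+e_{N-1})^T$, $\tfrac1{\sqrt2}(e_1-e_N)^T$, $\tfrac1{\sqrt2}(e_2-e_{N-1})^T$, so $\Omega\eta\Omega^T=\mathrm{diag}(1_{2+2s},-1_2)$. Let $H\cong\mathrm{SO}(2)\times\mathrm{SO}(2+2s)$ be the subgroup of the $g\in U$ with $\Omega g\Omega^T=\mathrm{diag}(A,B)$, $A\in\mathrm{SO}(2+2s)$, $B\in\mathrm{SO}(2)$. On $U/H$ let $d$ be the geodesic distance (infimum of lengths of $C^1$ curves) of the $U$-invariant metric $ds^2=\mathrm{Tr}(\mathbb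 V^2)$, where $\mathbb V$ is the symmetric part of $g^{-1}dg$. Solvable coordinates are vectors $\Upsilon=(\Upsilon_1,\Upsilon_2,\Upsilon_3,\Upsilon_4,\mathbf\Upsilon_5,\mathbf\Upsilon_6)$ with $\Upsilon_1,\dots,\Upsilon_4\in\mathbb R$ and $\mathbf\Upsilon_5,\mathbf\Upsilon_6\in\mathbb R^{2s}$. With $E_{ij}$ the matrix units, put $C=\Upsilon_1(E_{11}-E_{NN})+\Upsilon_2(E_{22}-E_{N-1,N-1})$, $\ell=\tfrac{1}{\sqrt2}\Upsilon_3(E_{12}-E_{N-1,N})+\tfrac1{\sqrt2}\Upsilon_4(E_{1,N-1}-E_{2,N})$, $\sigma_5=\tfrac1{\sqrt2}\sum_i\Upsilon_{5,i}(E_{1,2+i}-E_{2+i,N})$, $\sigma_6=\tfrac1{\sqrt2}\sum_i\Upsilon_{6,i}(E_{2,2+i}-E_{2+i,N-1})$, and $$\mathbb L(\Upsilon)=e^{C}\,e^{\ell}\,e^{\sigma_5}\,e^{\sigma_6}\in U .$$ Put $\mathrm N^2(\mathbf w)=d^2(H,\mathbb L(\mathbf w)H)$, and write $d(\mathbf U,\mathbf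 V)$ for $d(\mathbb L(\mathbf U)H,\mathbb L(\mathbf V)H)$. Then: 1. $\Upsilon\mapsto \mathbb L(\Upsilon)H$ is a bijection from $\mathbb R^4\times\mathbb R^{2s}\times\mathbb R^{2s}$ onto $U/H$, and $\mathbb L(\Upsilon)$ is the upper triangular matrix with non-zero entries ($i=1,\dots,2s$) $\mathbb L_{1,1}=e^{\Upsilon_1}$, $\mathbb L_{1,2}=\tfrac{1}{\sqrt2}e^{\Upsilon_1}\Upsilon_3$, $\mathbb L_{1,2+i}=\tfrac12e^{\Upsilon_1}(\sqrt2\,\Upsilon_{5,i}+\Upsilon_3\Upsilon_{6,i})$, $\mathbb L_{1,3+2s}=e^{\Upsilon_1}\bigl(-\tfrac12\mathbf\Upsilon_5\cdot\mathbf\Upsilon_6-\tfrac{\Upsilon_3|\mathbf\Upsilon_6|^2}{4\sqrt2}+\tfrac{\Upsilon_4}{\sqrt2}\bigr)$, $\mathbb L_{1,4+2s}=-\tfrac12e^{\Upsilon_1}(\tfrac12|\mathbf\Upsilon_5|^2+\Upsilon_3\Upsilon_4)$, $\mathbb L_{2,2}=e^{\Upsilon_2}$, $\mathbb L_{2,2+i}=\tfrac{1}{\sqrt2}e^{\Upsilon_2}\Upsilon_{6,i}$,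 $\mathbb L_{2,3+2s}=-\tfrac14e^{\Upsilon_2}|\mathbf\Upsilon_6|^2$, $\mathbb L_{2,4+2s}=-\tfrac1{\sqrt2}e^{\Upsilon_2}\Upsilon_4$, $\mathbb L_{2+i,2+i}=1$, $\mathbb L_{2+i,3+2s}=-\tfrac1{\sqrt2}\Upsilon_{6,i}$, $\mathbb L_{2+i,4+2s}=-\tfrac1{\sqrt2}\Upsilon_{5,i}$, $\mathbb L_{3+2s,3+2s}=e^{-\Upsilon_2}$, $\mathbb L_{3+2s,4+2s}=-\tfrac1{\sqrt2}e^{-\Upsilon_2}\Upsilon_3$, $\mathbb L_{4+2s,4+2s}=e^{-\Upsilon_1}$. 2. For all $\mathbf U=(u_1,\dots,u_4,\mathbf U_5,\mathbf U_6)$, $\mathbf V=(v_1,\dots,v_4,\mathbf V_5,\mathbf V_6)$ one has $\mathbb L(\mathbf U)^{-1}\mathbb L(\mathbf V)=\mathbb L(\mathbf W)$ with $$\begin{aligned} w_1&=v_1-u_1,\qquad w_2=v_2-u_2,\qquad w_3=v_3-e^{u_1-u_2-v_1+v_2}u_3,\\ w_4&=v_4+\tfrac1{\sqrt2}e^{u_2-v_1-v_2}\bigl(e^{u_1}\mathbf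 U_5\cdot\mathbf U_6-e^{v_1}\mathbf U_6\cdot\mathbf V_5\bigr)-\tfrac14e^{2(u_2-v_2)}v_3|\mathbf U_6|^2+\tfrac14e^{u_1+u_2-v_1-v_2}\bigl(u_3|\mathbf U_6|^2-4u_4\bigr),\\ \mathbf W_5&=\mathbf V_5+\tfrac1{\sqrt2}e^{u_2-v_2}v_3\mathbf U_6-\tfrac12e^{u_1-v_1}\bigl(\sqrt2\,u_3\mathbf U_6+2\mathbf U_5\bigr),\qquad \mathbf W_6=\mathbf V_6-e^{u_2-v_2}\mathbf U_6, \end{aligned}$$ and $d^2(\mathbf U,\mathbf V)=\mathrm N^2(\mathbf W)$. 3. For every coordinate vector $\mathbf W$ let $\mathcal L^{[1]},\mathcal L^{[2]}$ be the last two rows of $\Omega\,\mathbb L(\mathbf W)\,\Omega^T$. Then $$\begin{aligned} \mathcal L^{[1]}_{i}&=\tfrac1{2\sqrt2}e^{w_1}(\sqrt2\,W_{5,i}+w_3W_{6,i})\quad(1\le i\le 2s),\\ \mathcal L^{[1]}_{2s+1}&=-\tfrac12e^{-w_1}-\tfrac18e^{w_1}(-4+2w_3w_4+|\mathbf W_5|^2),\\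 \mathcal L^{[1]}_{2s+2}&=-\tfrac1{16}e^{w_1}\bigl(-4\sqrt2w_4+4\mathbf W_5\cdot\mathbf W_6+\sqrt2w_3(-4+|\mathbf W_6|^2)\bigr),\\ \mathcal L^{[1]}_{2s+3}&=\tfrac18e^{-w_1}\bigl(4+e^{2w_1}(4+2w_3w_4+|\mathbf W_5|^2)\bigr),\\ \mathcal L^{[1]}_{2s+4}&=\tfrac1{16}e^{w_1}\bigl(-4\sqrt2w_4+4\mathbf W_5\cdot\mathbf W_6+\sqrt2w_3(4+|\mathbf W_6|^2)\bigr),\\ \mathcal L^{[2]}_{i}&=\tfrac12e^{w_2}W_{6,i}\quad(1\le i\le 2s),\\ \mathcal L^{[2]}_{2s+1}&=\tfrac1{2\sqrt2}e^{-w_2}(w_3-e^{2w_2}w_4),\qquad \mathcal L^{[2]}_{2s+2}=-\tfrac12e^{-w_2}-\tfrac18e^{w_2}(-4+|\mathbf W_6|^2),\\ \mathcal L^{[2]}_{2s+3}&=\tfrac1{2\sqrt2}e^{-w_2}(-w_3+e^{2w_2}w_4),\qquad \mathcal L^{[2]}_{2s+4}=\tfrac18e^{-w_2}\bigl(4+e^{2w_2}(4+|\mathbf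 W_6|^2)\bigr). \end{aligned}$$ The lower right $2\times2$ block of $\Omega\,\mathbb L(\mathbf W)\mathbb L(\mathbf W)^T\,\Omega^T$ is the Gram matrix of $\mathcal L^{[1]},\mathcal L^{[2]}$; its eigenvalues, with multiplicity, are $$\Lambda_\pm(\mathbf W)=\tfrac12\Bigl(|\mathcal L^{[1]}|^2+|\mathcal L^{[2]}|^2\pm\sqrt{(|\mathcal L^{[1]}|^2-|\mathcal L^{[2]}|^2)^2+4(\mathcal L^{[1]}\cdot\mathcal L^{[2]})^2}\Bigr),\qquad \Lambda_+\ge\Lambda_-\ge1,$$ and with $\mathbf W$ as in 2, $$d^2(\mathbf U,\mathbf V)=\tfrac12(\operatorname{arccosh}\Lambda_+(\mathbf W))^2+\tfrac12(\operatorname{arccosh}\Lambda_-(\mathbf W))^2 .$$ 4. For $\mathbf w=(w_1,\dots,w_4,\mathbb U,\mathbb V)$ one has $\mathfrak B_{\mathbf w}\ge0$, $\Lambda_\pm(\mathbf w)=\tfrac12(\mathfrak A_{\mathbf w}\pm\sqrt{\mathfrak B_{\mathbf w}})$ and $$\mathrm N^2(\mathbf w)=\tfrac12\Bigl(\operatorname{arccosh}\tfrac12(\mathfrak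 A_{\mathbf w}-\sqrt{\mathfrak B_{\mathbf w}})\Bigr)^2+\tfrac12\Bigl(\operatorname{arccosh}\tfrac12(\mathfrak A_{\mathbf w}+\sqrt{\mathfrak B_{\mathbf w}})\Bigr)^2,$$ where, with $P=\mathbb U^2+2w_3w_4+4$, $Q=4\,\mathbb U\cdot\mathbb V+\sqrt2\bigl((\mathbb V^2+4)w_3-4w_4\bigr)$, $R=\mathbb U^2+e^{-2w_2}w_3^2+e^{2w_2}w_4^2$, $S=\mathbb V^2e^{w_2}+8\sinh w_2$, $T=\mathbb V^2\sinh w_2+(\mathbb V^2+8)\cosh w_2$, $$\begin{aligned} \mathfrak A_{\mathbf w}&=\tfrac1{128}\bigl(32\mathbb V^2+4e^{2w_1}P^2+32R+e^{2w_1}Q^2+2S^2+2T^2+64e^{-2w_1}\bigr),\\ \mathfrak B_{\mathbf w}&=\tfrac1{16384}\Bigl(16e^{-4w_2}\bigl(e^{2(w_1+w_2)}PQ+4(4\,\mathbb U\cdot\mathbb V\,e^{2w_2}+\sqrt2(\mathbb V^2+4)e^{4w_2}w_4-4\sqrt2w_3)\bigr)^2\\ &\qquad+\bigl(32\mathbb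 V^2-4e^{2w_1}P^2-32R+e^{2w_1}Q^2+2S^2+2T^2-64e^{-2w_1}\bigr)^2\Bigr). \end{aligned}$$ Thus $\mathrm N^2$ depends only on the seven quantities $w_1,w_2,w_3,w_4,\mathbb U^2,\mathbb V^2,\mathbb U\cdot\mathbb V$. These are invariant under the paint group $\mathrm{SO}(2s)$, which fixes the four scalar coordinates and rotates both vector coordinates simultaneously; hence so are $\mathrm N^2$ and the distance: $\mathrm N^2(R\mathbf w)=\mathrm N^2(\mathbf w)$ and $d(R\mathbf U,R\mathbf V)=d(\mathbf U,\mathbf V)$ for $R\in\mathrm{SO}(2s)$. -/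

import Mathlib

open Matrix Set

noncomputable section

namespace PaintDistance

/-! ### The group `SO(2, 2+2s)` in the triangular basis -/

/-- Indices `1, …, 2s+4` of the fundamental representation in the triangular basis, split as
`{1, 2}`, `{3, …, 2s+2}`, `{2s+3, 2s+4}`. -/
abbrev IdxT (s : ℕ) : Type := Fin 2 ⊕ (Fin (2 * s) ⊕ Fin 2)

/-- Indices `1, …, 2s+4` of the fundamental representation in the block-diagonal basis, split as
`{1, …, 2s}`, `{2s+1, 2s+2}` (together the `2s+2` positive directions) and `{2s+3, 2s+4}` (the two
negative directions). -/
abbrev IdxB (s : ℕ) : Type := (Fin (2 * s) ⊕ Fin 2) ⊕ Fin 2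

/-- The invariant form of signature `(2+2s, 2)` in the triangular basis: the unit matrix on the
middle block, antidiagonal on the indices `1, 2, 2s+3, 2s+4`. -/
def etaT (s : ℕ) : Matrix (IdxT s) (IdxT s) ℝ :=
  Matrix.of fun i j => match i, j with
    | .inl a, .inr (.inr b) => if b = a.rev then 1 else 0
    | .inr (.inl k), .inr (.inl l) => if k = l then 1 else 0
    | .inr (.inr b), .inl a => if b = a.rev then 1 else 0
    | _, _ => 0

/-- The orthogonal change of basis from the triangular to the block-diagonal basis. -/
def Omega (s : ℕ) : Matrix (IdxB s) (IdxT s) ℝ :=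
  Matrix.of fun i j => match i, j with
    | .inl (.inl k), .inr (.inl l) => if k = l then 1 else 0
    | .inl (.inr a), .inl b => if a = b then 1 / √2 else 0
    | .inl (.inr a), .inr (.inr b) => if b = a.rev then 1 / √2 else 0
    | .inr a, .inl b => if a = b then 1 / √2 else 0
    | .inr a, .inr (.inr b) => if b = a.rev then -(1 / √2) else 0
    | _, _ => 0

lemma inv_sqrt_two_mul_self : (√2)⁻¹ * (√2)⁻¹ = (1 / 2 : ℝ) := by
  rw [← mul_inv, Real.mul_self_sqrt (by norm_num)]; norm_num

lemma etaT_transpose (s : ℕ) : (etaT s)ᵀ = etaT s := by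
  ext (i | i | i) (j | j | j) <;> simp [etaT, eq_comm]

lemma etaT_mul_self (s : ℕ) : etaT s * etaT s = 1 := by
  ext (i | i | i) (j | j | j)
  case inr.inr.inr.inr =>
    fin_cases i <;> fin_cases j <;>
      simp [etaT, Matrix.mul_apply, Fintype.sum_sum_type, Fin.rev]
  all_goals
    simp [etaT, Matrix.mul_apply, Fintype.sum_sum_type, Matrix.one_apply, Fin.rev_eq_iff,
      eq_comm]

lemma Omega_mul_transpose (s : ℕ) : Omega s * (Omega s)ᵀ = 1 := by
  ext ((i | i) | i) ((j | j) | j)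
  case inl.inl.inl.inl =>
    simp [Omega, Matrix.mul_apply, Fintype.sum_sum_type, Matrix.one_apply]
  case inl.inr.inl.inr | inl.inr.inr | inr.inl.inr | inr.inr =>
    fin_cases i <;> fin_cases j <;>
      simp [Omega, Matrix.mul_apply, Fintype.sum_sum_type, Fin.rev,
        inv_sqrt_two_mul_self] <;> norm_num
  all_goals simp [Omega, Matrix.mul_apply, Fintype.sum_sum_type]

lemma Omega_transpose_mul (s : ℕ) : (Omega s)ᵀ * Omega s = 1 :=
  (Matrix.mul_eq_one_comm_of_card_eq _ _ _ (by
    simp only [Fintype.card_sum, Fintype.card_fin]; omega)).1 (Omega_mul_transpose s)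

/-- `SO(η)`: the real matrices `g` with `det g = 1` and `gᵀ η g = η`. -/
def pseudoSO (s : ℕ) : Subgroup (Matrix.SpecialLinearGroup (IdxT s) ℝ) where
  carrier := {g | (g.1)ᵀ * etaT s * g.1 = etaT s}
  one_mem' := by simp
  mul_mem' := by
    intro a b ha hb
    change (a.1)ᵀ * etaT s * a.1 = etaT s at ha
    change (b.1)ᵀ * etaT s * b.1 = etaT s at hb
    change ((a * b).1)ᵀ * etaT s * (a * b).1 = etaT s
    calc ((a * b).1)ᵀ * etaT s * (a * b).1
        = (b.1)ᵀ * ((a.1)ᵀ * etaT s * a.1) * b.1 := by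
          simp [Matrix.transpose_mul, Matrix.mul_assoc]
      _ = etaT s := by rw [ha, hb]
  inv_mem' := by
    intro a ha
    change (a.1)ᵀ * etaT s * a.1 = etaT s at ha
    change ((a⁻¹).1)ᵀ * etaT s * (a⁻¹).1 = etaT s
    have h1 : a.1 * (a⁻¹).1 = 1 := congrArg Subtype.val (mul_inv_cancel a)
    have h2 : ((a⁻¹).1)ᵀ * (a.1)ᵀ = 1 := by
      rw [← Matrix.transpose_mul, h1, Matrix.transpose_one]
    calc ((a⁻¹).1)ᵀ * etaT s * (a⁻¹).1
        = ((a⁻¹).1)ᵀ * ((a.1)ᵀ * etaT s * a.1) * (a⁻¹).1 := by rw [ha]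
      _ = (((a⁻¹).1)ᵀ * (a.1)ᵀ) * etaT s * (a.1 * (a⁻¹).1) := by
          simp only [Matrix.mul_assoc]
      _ = etaT s := by rw [h1, h2, Matrix.one_mul, Matrix.mul_one]

/-- The group `U = SO(2, 2+2s)`, that is, the identity component of `SO(η)`. -/
abbrev SO0 (s : ℕ) : Type := Subgroup.connectedComponentOfOne (pseudoSO s)

/-- The matrix, in the triangular basis, of an element of `SO(2, 2+2s)`. -/
def toMat {s : ℕ} (g : SO0 s) : Matrix (IdxT s) (IdxT s) ℝ := g.1.1.1

lemma toMat_mul {s : ℕ} (g h : SO0 s) : toMat (g * h) = toMat g * toMat h := rfl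

lemma toMat_one {s : ℕ} : toMat (1 : SO0 s) = 1 := rfl

lemma star_mem_SO {n : Type*} [Fintype n] [DecidableEq n] {A : Matrix n n ℝ}
    (hA : A ∈ Matrix.specialOrthogonalGroup n ℝ) : star A ∈ Matrix.specialOrthogonalGroup n ℝ := by
  rw [Matrix.mem_specialOrthogonalGroup_iff] at hA ⊢
  refine ⟨Unitary.star_mem hA.1, ?_⟩
  rw [Matrix.star_eq_conjTranspose, Matrix.det_conjTranspose, hA.2, star_one]

/-- The maximal compact subgroup `SO(2+2s) × SO(2)`: the elements of `SO(2, 2+2s)` that in the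
block-diagonal basis have the form `diag(A, B)` with `A ∈ SO(2+2s)` and `B ∈ SO(2)`. -/
def Hc (s : ℕ) : Subgroup (SO0 s) where
  carrier := {g | ∃ A ∈ Matrix.specialOrthogonalGroup (Fin (2 * s) ⊕ Fin 2) ℝ,
    ∃ B ∈ Matrix.specialOrthogonalGroup (Fin 2) ℝ,
      Omega s * toMat g * (Omega s)ᵀ = Matrix.fromBlocks A 0 0 B}
  one_mem' := ⟨1, one_mem _, 1, one_mem _, by
    rw [toMat_one, Matrix.mul_one, Omega_mul_transpose, Matrix.fromBlocks_one]⟩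
  mul_mem' := by
    rintro a b ⟨A, hA, B, hB, h⟩ ⟨A', hA', B', hB', h'⟩
    refine ⟨A * A', mul_mem hA hA', B * B', mul_mem hB hB', ?_⟩
    calc Omega s * toMat (a * b) * (Omega s)ᵀ
        = Omega s * toMat a * ((Omega s)ᵀ * Omega s) * toMat b * (Omega s)ᵀ := by
          rw [Omega_transpose_mul, Matrix.mul_one, toMat_mul]; simp only [Matrix.mul_assoc]
      _ = (Omega s * toMat a * (Omega s)ᵀ) * (Omega s * toMat b * (Omega s)ᵀ) := by
          simp only [Matrix.mul_assoc]
      _ = _ := by rw [h, h', Matrix.fromBlocks_multiply]; simp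
  inv_mem' := by
    rintro a ⟨A, hA, B, hB, h⟩
    have hA1 : star A * A = 1 := (Matrix.mem_orthogonalGroup_iff' _ _).1 hA.1
    have hB1 : star B * B = 1 := (Matrix.mem_orthogonalGroup_iff' _ _).1 hB.1
    refine ⟨star A, star_mem_SO hA, star B, star_mem_SO hB, ?_⟩
    have h1 : toMat a * toMat a⁻¹ = 1 := by rw [← toMat_mul, mul_inv_cancel, toMat_one]
    have h2 : (Omega s * toMat a * (Omega s)ᵀ) * (Omega s * toMat a⁻¹ * (Omega s)ᵀ) = 1 := by
      calc _ = Omega s * toMat a * ((Omega s)ᵀ * Omega s) * toMat a⁻¹ * (Omega s)ᵀ := by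
            simp only [Matrix.mul_assoc]
        _ = Omega s * (toMat a * toMat a⁻¹) * (Omega s)ᵀ := by
            rw [Omega_transpose_mul, Matrix.mul_one]; simp only [Matrix.mul_assoc]
        _ = 1 := by rw [h1, Matrix.mul_one, Omega_mul_transpose]
    have h3 : Matrix.fromBlocks (star A) 0 0 (star B) * (Omega s * toMat a * (Omega s)ᵀ) = 1 := by
      rw [h, Matrix.fromBlocks_multiply, hA1, hB1]
      simp
    calc Omega s * toMat a⁻¹ * (Omega s)ᵀ
        = (Matrix.fromBlocks (star A) 0 0 (star B) * (Omega s * toMat a * (Omega s)ᵀ))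
            * (Omega s * toMat a⁻¹ * (Omega s)ᵀ) := by rw [h3, Matrix.one_mul]
      _ = Matrix.fromBlocks (star A) 0 0 (star B) := by
          rw [Matrix.mul_assoc, h2, Matrix.mul_one]

/-- The symmetric space `SO(2, 2+2s) / SO(2) × SO(2+2s)`. -/
abbrev SymmSpace (s : ℕ) : Type := SO0 s ⧸ Hc s

/-! ### The invariant metric and the geodesic distance -/

/-- `γ` restricted to `[0, 1]` is a `C¹` curve in `SO(2, 2+2s)`. -/
def IsC1Curve {s : ℕ} (γ : ℝ → SO0 s) : Prop :=
  ∀ i j, ContDiffOn ℝ 1 (fun t => toMat (γ t) i j) (Icc 0 1)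

/-- The derivative `γ'(t)` of a curve. -/
def velocity {s : ℕ} (γ : ℝ → SO0 s) (t : ℝ) : Matrix (IdxT s) (IdxT s) ℝ :=
  Matrix.of fun i j => derivWithin (fun τ => toMat (γ τ) i j) (Icc 0 1) t

/-- The pull-back to a curve of the left-invariant one-form `Θ = g⁻¹ dg`. -/
def leftForm {s : ℕ} (γ : ℝ → SO0 s) (t : ℝ) : Matrix (IdxT s) (IdxT s) ℝ :=
  toMat (γ t)⁻¹ * velocity γ t

/-- The vielbein along a curve: the projection of `Θ` onto the symmetric matrices, the orthogonal
complement of the Lie algebra of the maximal compact subgroup. -/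
def vielbein {s : ℕ} (γ : ℝ → SO0 s) (t : ℝ) : Matrix (IdxT s) (IdxT s) ℝ :=
  (1 / 2 : ℝ) • (leftForm γ t + (leftForm γ t)ᵀ)

/-- The length, for the invariant metric `ds² = Tr(V²)`, of the curve in the symmetric space
represented by the curve `γ` in the group. It depends only on the curve of cosets. -/
def curveLength {s : ℕ} (γ : ℝ → SO0 s) : ℝ :=
  ∫ t in (0 : ℝ)..1, √((vielbein γ t * vielbein γ t).trace)

/-- The geodesic distance of the symmetric space: the infimum of the lengths of the `C¹` curves
joining two points. -/
def geodDist {s : ℕ} (p q : SymmSpace s) : ℝ :=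
  sInf {ℓ : ℝ | ∃ γ : ℝ → SO0 s, IsC1Curve γ ∧ (γ 0 : SymmSpace s) = p ∧
    (γ 1 : SymmSpace s) = q ∧ curveLength γ = ℓ}

/-! ### Solvable coordinates -/

/-- A solvable coordinate vector: two Cartan coordinates `x1, x2`, two long root coordinates
`x3, x4`, and two `2s`-component short root coordinates `x5, x6`. -/
@[ext]
structure SolvCoord (s : ℕ) where
  x1 : ℝ
  x2 : ℝ
  x3 : ℝ
  x4 : ℝ
  x5 : Fin (2 * s) → ℝ
  x6 : Fin (2 * s) → ℝ

variable {s : ℕ}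

/-- The Cartan part of the solvable Lie algebra element with coordinates `Y`. -/
def cartanPart (Y : SolvCoord s) : Matrix (IdxT s) (IdxT s) ℝ :=
  Matrix.diagonal (Sum.elim ![Y.x1, Y.x2] (Sum.elim (fun _ => 0) ![-Y.x2, -Y.x1]))

/-- The long root part. -/
def longPart (Y : SolvCoord s) : Matrix (IdxT s) (IdxT s) ℝ :=
  Matrix.fromBlocks !![0, Y.x3 / √2; 0, 0]
    (Matrix.fromCols 0 !![Y.x4 / √2, 0; 0, -(Y.x4 / √2)])
    0 (Matrix.fromBlocks 0 0 0 !![0, -(Y.x3 / √2); 0, 0])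

/-- The part along the preimages of the first short root. -/
def shortPart5 (Y : SolvCoord s) : Matrix (IdxT s) (IdxT s) ℝ :=
  Matrix.fromBlocks 0
    (Matrix.fromCols (Matrix.of ![fun k => Y.x5 k / √2, fun _ => 0]) 0)
    0 (Matrix.fromBlocks 0 (Matrix.of fun k => ![0, -(Y.x5 k / √2)]) 0 0)

/-- The part along the preimages of the second short root. -/
def shortPart6 (Y : SolvCoord s) : Matrix (IdxT s) (IdxT s) ℝ :=
  Matrix.fromBlocks 0
    (Matrix.fromCols (Matrix.of ![fun _ => 0, fun k => Y.x6 k / √2]) 0)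
    0 (Matrix.fromBlocks 0 (Matrix.of fun k => ![-(Y.x6 k / √2), 0]) 0 0)

/-- The Lie algebra `so(2, 2+2s)` in the triangular basis. -/
def InLie (X : Matrix (IdxT s) (IdxT s) ℝ) : Prop := Xᵀ * etaT s + etaT s * X = 0

lemma mul_etaT_apply_inl (X : Matrix (IdxT s) (IdxT s) ℝ) (i : IdxT s) (a : Fin 2) :
    (X * etaT s) i (.inl a) = X i (.inr (.inr a.rev)) := by
  simp [Matrix.mul_apply, Fintype.sum_sum_type, etaT]

lemma mul_etaT_apply_mid (X : Matrix (IdxT s) (IdxT s) ℝ) (i : IdxT s) (k : Fin (2 * s)) :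
    (X * etaT s) i (.inr (.inl k)) = X i (.inr (.inl k)) := by
  simp [Matrix.mul_apply, Fintype.sum_sum_type, etaT]

lemma mul_etaT_apply_inr (X : Matrix (IdxT s) (IdxT s) ℝ) (i : IdxT s) (a : Fin 2) :
    (X * etaT s) i (.inr (.inr a)) = X i (.inl a.rev) := by
  have h : ∀ x : Fin 2, (a = x.rev) ↔ (x = a.rev) := fun x => by
    rw [eq_comm, Fin.rev_eq_iff]
  simp [Matrix.mul_apply, Fintype.sum_sum_type, etaT, h]

lemma inLie_of {X : Matrix (IdxT s) (IdxT s) ℝ}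
    (h : Xᵀ * etaT s = -(Xᵀ * etaT s)ᵀ) : InLie X := by
  unfold InLie
  rw [Matrix.transpose_mul, etaT_transpose, Matrix.transpose_transpose] at h
  rw [h]; simp

lemma inLie_cartanPart (Y : SolvCoord s) : InLie (cartanPart Y) := by
  apply inLie_of
  ext (i | i | i) (j | j | j) <;>
    simp only [mul_etaT_apply_inl, mul_etaT_apply_mid, mul_etaT_apply_inr, Matrix.neg_apply,
      Matrix.transpose_apply]
  case inl.inr.inr | inr.inr.inl =>
    fin_cases i <;> fin_cases j <;> simp [cartanPart, Fin.rev]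
  all_goals simp [cartanPart, Matrix.diagonal_apply]

lemma inLie_longPart (Y : SolvCoord s) : InLie (longPart Y) := by
  apply inLie_of
  ext (i | i | i) (j | j | j) <;>
    simp only [mul_etaT_apply_inl, mul_etaT_apply_mid, mul_etaT_apply_inr, Matrix.neg_apply,
      Matrix.transpose_apply]
  case inl.inr.inl | inr.inl.inl | inr.inl.inr.inl | inr.inl.inr.inr | inr.inr.inr.inl =>
    simp [longPart]
  all_goals fin_cases i <;> fin_cases j <;> simp [longPart, Fin.rev]

lemma inLie_shortPart5 (Y : SolvCoord s) : InLie (shortPart5 Y) := by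
  apply inLie_of
  ext (i | i | i) (j | j | j) <;>
    simp only [mul_etaT_apply_inl, mul_etaT_apply_mid, mul_etaT_apply_inr, Matrix.neg_apply,
      Matrix.transpose_apply]
  case inr.inl.inl | inr.inl.inr.inr => fin_cases j <;> simp [shortPart5, Fin.rev]
  case inl.inr.inl | inr.inr.inr.inl => fin_cases i <;> simp [shortPart5, Fin.rev]
  all_goals simp [shortPart5]

lemma inLie_shortPart6 (Y : SolvCoord s) : InLie (shortPart6 Y) := by
  apply inLie_of
  ext (i | i | i) (j | j | j) <;>
    simp only [mul_etaT_apply_inl, mul_etaT_apply_mid, mul_etaT_apply_inr, Matrix.neg_apply,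
      Matrix.transpose_apply]
  case inr.inl.inl | inr.inl.inr.inr => fin_cases j <;> simp [shortPart6, Fin.rev]
  case inl.inr.inl | inr.inr.inr.inl => fin_cases i <;> simp [shortPart6, Fin.rev]
  all_goals simp [shortPart6]

lemma InLie.smul {X : Matrix (IdxT s) (IdxT s) ℝ} (h : InLie X) (t : ℝ) : InLie (t • X) := by
  unfold InLie at h ⊢
  rw [Matrix.transpose_smul, Matrix.smul_mul, Matrix.mul_smul, ← smul_add, h, smul_zero]

lemma InLie.exp_preserves {X : Matrix (IdxT s) (IdxT s) ℝ} (h : InLie X) :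
    (NormedSpace.exp X)ᵀ * etaT s * NormedSpace.exp X = etaT s := by
  have hinv : (etaT s)⁻¹ = etaT s := Matrix.inv_eq_left_inv (etaT_mul_self s)
  have hX : Xᵀ = etaT s * (-X) * (etaT s)⁻¹ := by
    have h1 : Xᵀ * etaT s = -(etaT s * X) := eq_neg_of_add_eq_zero_left h
    rw [hinv, Matrix.mul_neg, ← h1, Matrix.mul_assoc, etaT_mul_self, Matrix.mul_one]
  have hu : IsUnit (etaT s) := IsUnit.of_mul_eq_one _ (etaT_mul_self s)
  have he : NormedSpace.exp (-X) * NormedSpace.exp X = 1 := by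
    rw [← Matrix.exp_add_of_commute _ _ (Commute.neg_left (Commute.refl X)), neg_add_cancel,
      NormedSpace.exp_zero]
  rw [← Matrix.exp_transpose, hX, Matrix.exp_conj _ _ hu, hinv,
    Matrix.mul_assoc _ (etaT s) (etaT s), etaT_mul_self, Matrix.mul_one, Matrix.mul_assoc, he,
    Matrix.mul_one]

lemma InLie.det_exp {X : Matrix (IdxT s) (IdxT s) ℝ} (h : InLie X) :
    (NormedSpace.exp X).det = 1 := by
  have hη : (etaT s).det * (etaT s).det = 1 := by
    rw [← Matrix.det_mul, etaT_mul_self, Matrix.det_one]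
  have key : ∀ Z : Matrix (IdxT s) (IdxT s) ℝ, InLie Z →
      (NormedSpace.exp Z).det * (NormedSpace.exp Z).det = 1 := by
    intro Z hZ
    have h1 := congrArg Matrix.det hZ.exp_preserves
    rw [Matrix.det_mul, Matrix.det_mul, Matrix.det_transpose] at h1
    have h2 : (etaT s).det ≠ 0 := fun h0 => by simp [h0] at hη
    apply mul_right_cancel₀ h2
    linarith
  have h2 : X = (1 / 2 : ℝ) • X + (1 / 2 : ℝ) • X := by
    rw [← add_smul]; norm_num
  rw [h2, Matrix.exp_add_of_commute _ _ (Commute.refl _), Matrix.det_mul]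
  exact key _ (h.smul _)

/-- The exponential of a Lie algebra element, as an element of `SO(η)`. -/
def expSO (X : Matrix (IdxT s) (IdxT s) ℝ) (h : InLie X) : pseudoSO s :=
  ⟨⟨NormedSpace.exp X, h.det_exp⟩, h.exp_preserves⟩

lemma continuous_matrix_exp :
    Continuous (NormedSpace.exp : Matrix (IdxT s) (IdxT s) ℝ → Matrix (IdxT s) (IdxT s) ℝ) := by
  open scoped Norms.Operator in exact NormedSpace.exp_continuous

lemma expSO_mem (X : Matrix (IdxT s) (IdxT s) ℝ) (h : InLie X) :
    expSO X h ∈ Subgroup.connectedComponentOfOne (pseudoSO s) := by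
  let c : ℝ → pseudoSO s := fun t => expSO (t • X) (h.smul t)
  have hc : Continuous c := by
    refine Continuous.subtype_mk (Continuous.subtype_mk ?_ _) _
    exact continuous_matrix_exp.comp (by fun_prop)
  have h0 : c 0 = 1 := by
    apply Subtype.ext; apply Subtype.ext
    change NormedSpace.exp ((0 : ℝ) • X) = 1
    rw [zero_smul, NormedSpace.exp_zero]
  have h1 : c 1 = expSO X h := by
    apply Subtype.ext; apply Subtype.ext
    change NormedSpace.exp ((1 : ℝ) • X) = NormedSpace.exp X
    rw [one_smul]
  have hr : IsPreconnected (range c) := isPreconnected_range hc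
  have := hr.subset_connectedComponent (x := 1) ⟨0, h0⟩ ⟨1, h1⟩
  exact this

/-- The exponential of a Lie algebra element, as an element of `SO(2, 2+2s)`. -/
def expU (X : Matrix (IdxT s) (IdxT s) ℝ) (h : InLie X) : SO0 s := ⟨expSO X h, expSO_mem X h⟩

/-- The map `Σ` from the solvable Lie algebra to the solvable group: the ordered product of the
exponentials of the Cartan part, of the long root part and of the parts along the two short roots.
Its image is the coset representative `𝕃(Y)`. -/
def cosetRep (Y : SolvCoord s) : SO0 s :=
  expU (cartanPart Y) (inLie_cartanPart Y) * expU (longPart Y) (inLie_longPart Y) *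
    expU (shortPart5 Y) (inLie_shortPart5 Y) * expU (shortPart6 Y) (inLie_shortPart6 Y)

/-- The point of the symmetric space with solvable coordinates `Y`. -/
def point (Y : SolvCoord s) : SymmSpace s := (cosetRep Y : SymmSpace s)

/-- The squared norm of an element: the squared geodesic distance of its point from the origin. -/
def sqNorm (g : SO0 s) : ℝ := geodDist ((1 : SO0 s) : SymmSpace s) (g : SymmSpace s) ^ 2

/-- The explicit form of the matrix `𝕃(Y)`. -/
def explicitL (Y : SolvCoord s) : Matrix (IdxT s) (IdxT s) ℝ :=
  Matrix.fromBlocks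
    !![Real.exp Y.x1, Real.exp Y.x1 * Y.x3 / √2;
       0, Real.exp Y.x2]
    (Matrix.fromCols
      (Matrix.of ![fun k => 1 / 2 * Real.exp Y.x1 * (√2 * Y.x5 k + Y.x3 * Y.x6 k),
        fun k => Real.exp Y.x2 / √2 * Y.x6 k])
      !![Real.exp Y.x1 *
            (-(1 / 2) * (Y.x5 ⬝ᵥ Y.x6) - Y.x3 * (Y.x6 ⬝ᵥ Y.x6) / (4 * √2) + Y.x4 / √2),
          -(1 / 2) * Real.exp Y.x1 * (1 / 2 * (Y.x5 ⬝ᵥ Y.x5) + Y.x3 * Y.x4);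
         -(1 / 4) * Real.exp Y.x2 * (Y.x6 ⬝ᵥ Y.x6),
          -(Real.exp Y.x2 / √2) * Y.x4])
    0
    (Matrix.fromBlocks 1 (Matrix.of fun k => ![-(1 / √2) * Y.x6 k, -(1 / √2) * Y.x5 k])
      0 !![Real.exp (-Y.x2), -(Real.exp (-Y.x2) / √2) * Y.x3;
           0, Real.exp (-Y.x1)])

/-- The explicit coordinates of `u⁻¹ · v` in terms of those of `u` and `v`. -/
def quotCoord (U V : SolvCoord s) : SolvCoord s where
  x1 := V.x1 - U.x1
  x2 := V.x2 - U.x2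
  x3 := V.x3 - Real.exp (U.x1 - U.x2 - V.x1 + V.x2) * U.x3
  x4 := V.x4
    + 1 / √2 * (Real.exp (U.x2 - V.x1 - V.x2) *
        (Real.exp U.x1 * (U.x5 ⬝ᵥ U.x6) - Real.exp V.x1 * (U.x6 ⬝ᵥ V.x5)))
    - 1 / 4 * Real.exp (2 * (U.x2 - V.x2)) * V.x3 * (U.x6 ⬝ᵥ U.x6)
    + 1 / 4 * Real.exp (U.x1 + U.x2 - V.x1 - V.x2) * (U.x3 * (U.x6 ⬝ᵥ U.x6) - 4 * U.x4)
  x5 := V.x5 + (1 / √2 * Real.exp (U.x2 - V.x2) * V.x3) • U.x6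
    - (1 / 2 * Real.exp (U.x1 - V.x1)) • ((√2 * U.x3) • U.x6 + (2 : ℝ) • U.x5)
  x6 := V.x6 - Real.exp (U.x2 - V.x2) • U.x6

/-! ### The vectors `𝓛⁽¹⁾`, `𝓛⁽²⁾`, their Gram matrix and the distance formula -/

/-- The matrix `𝕃(W)` in the block-diagonal basis. -/
def hatL (W : SolvCoord s) : Matrix (IdxB s) (IdxB s) ℝ :=
  Omega s * toMat (cosetRep W) * (Omega s)ᵀ

/-- The symmetric matrix `M = 𝕃 𝕃ᵀ` in the block-diagonal basis. -/
def harmonicM (W : SolvCoord s) : Matrix (IdxB s) (IdxB s) ℝ :=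
  Omega s * (toMat (cosetRep W) * (toMat (cosetRep W))ᵀ) * (Omega s)ᵀ

/-- The last two rows of `hatL W`: `lastRow W 0` is `𝓛⁽¹⁾` and `lastRow W 1` is `𝓛⁽²⁾`. -/
def lastRow (W : SolvCoord s) (a : Fin 2) : IdxB s → ℝ := hatL W (.inr a)

/-- The explicit form of `𝓛⁽¹⁾`. -/
def explicitRow1 (W : SolvCoord s) : IdxB s → ℝ :=
  Sum.elim
    (Sum.elim (fun k => 1 / (2 * √2) * Real.exp W.x1 * (√2 * W.x5 k + W.x3 * W.x6 k))
      ![-(1 / 2) * Real.exp (-W.x1)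
          - 1 / 8 * Real.exp W.x1 * (-4 + 2 * W.x3 * W.x4 + W.x5 ⬝ᵥ W.x5),
        -(1 / 16) * Real.exp W.x1 * (-4 * √2 * W.x4 + 4 * (W.x5 ⬝ᵥ W.x6)
          + √2 * W.x3 * (-4 + W.x6 ⬝ᵥ W.x6))])
    ![1 / 8 * Real.exp (-W.x1) *
        (4 + Real.exp (2 * W.x1) * (4 + 2 * W.x3 * W.x4 + W.x5 ⬝ᵥ W.x5)),
      1 / 16 * Real.exp W.x1 * (-4 * √2 * W.x4 + 4 * (W.x5 ⬝ᵥ W.x6)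
          + √2 * W.x3 * (4 + W.x6 ⬝ᵥ W.x6))]

/-- The explicit form of `𝓛⁽²⁾`. -/
def explicitRow2 (W : SolvCoord s) : IdxB s → ℝ :=
  Sum.elim
    (Sum.elim (fun k => 1 / 2 * Real.exp W.x2 * W.x6 k)
      ![1 / (2 * √2) * Real.exp (-W.x2) * (W.x3 - Real.exp (2 * W.x2) * W.x4),
        -(1 / 2) * Real.exp (-W.x2) - 1 / 8 * Real.exp W.x2 * (-4 + W.x6 ⬝ᵥ W.x6)])
    ![1 / (2 * √2) * Real.exp (-W.x2) * (-W.x3 + Real.exp (2 * W.x2) * W.x4),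
      1 / 8 * Real.exp (-W.x2) * (4 + Real.exp (2 * W.x2) * (4 + W.x6 ⬝ᵥ W.x6))]

/-- The Gram matrix of `𝓛⁽¹⁾`, `𝓛⁽²⁾`. -/
def gramM (W : SolvCoord s) : Matrix (Fin 2) (Fin 2) ℝ :=
  Matrix.of fun a b => lastRow W a ⬝ᵥ lastRow W b

/-- The larger eigenvalue `Λ₊` of the Gram matrix. -/
def lambdaPlus (W : SolvCoord s) : ℝ :=
  1 / 2 * (lastRow W 0 ⬝ᵥ lastRow W 0 + lastRow W 1 ⬝ᵥ lastRow W 1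
    + √((lastRow W 0 ⬝ᵥ lastRow W 0 - lastRow W 1 ⬝ᵥ lastRow W 1) ^ 2
      + 4 * (lastRow W 0 ⬝ᵥ lastRow W 1) ^ 2))

/-- The smaller eigenvalue `Λ₋` of the Gram matrix. -/
def lambdaMinus (W : SolvCoord s) : ℝ :=
  1 / 2 * (lastRow W 0 ⬝ᵥ lastRow W 0 + lastRow W 1 ⬝ᵥ lastRow W 1
    - √((lastRow W 0 ⬝ᵥ lastRow W 0 - lastRow W 1 ⬝ᵥ lastRow W 1) ^ 2
      + 4 * (lastRow W 0 ⬝ᵥ lastRow W 1) ^ 2))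

end PaintDistance

namespace PaintDistance

open Real

/-- The function `𝔄` of the seven invariants `w₁, …, w₄`, `uu = 𝕌²`, `vv = 𝕍²`, `uv = 𝕌·𝕍`. -/
def invA (w1 w2 w3 w4 uu vv uv : ℝ) : ℝ :=
  1 / 128 * (32 * vv + 4 * exp (2 * w1) * (uu + 2 * w3 * w4 + 4) ^ 2
    + 32 * (uu + exp (-2 * w2) * w3 ^ 2 + exp (2 * w2) * w4 ^ 2)
    + exp (2 * w1) * (4 * uv + √2 * ((vv + 4) * w3 - 4 * w4)) ^ 2
    + 2 * (vv * exp w2 + 8 * sinh w2) ^ 2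
    + 2 * (vv * sinh w2 + (vv + 8) * cosh w2) ^ 2
    + 64 * exp (-2 * w1))

/-- The function `𝔅` of the seven invariants. -/
def invB (w1 w2 w3 w4 uu vv uv : ℝ) : ℝ :=
  1 / 16384 * (16 * exp (-4 * w2) *
      (exp (2 * (w1 + w2)) * (uu + 2 * w3 * w4 + 4)
          * (4 * uv + √2 * ((vv + 4) * w3 - 4 * w4))
        + 4 * (4 * uv * exp (2 * w2) + √2 * (vv + 4) * exp (4 * w2) * w4
          - 4 * √2 * w3)) ^ 2
    + (32 * vv - 4 * exp (2 * w1) * (uu + 2 * w3 * w4 + 4) ^ 2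
        - 32 * (uu + exp (-2 * w2) * w3 ^ 2 + exp (2 * w2) * w4 ^ 2)
        + exp (2 * w1) * (4 * uv + √2 * ((vv + 4) * w3 - 4 * w4)) ^ 2
        + 2 * (vv * exp w2 + 8 * sinh w2) ^ 2
        + 2 * (vv * sinh w2 + (vv + 8) * cosh w2) ^ 2
        - 64 * exp (-2 * w1)) ^ 2)

/-- The squared norm as a function of the seven invariants. -/
def sqNormFormula (w1 w2 w3 w4 uu vv uv : ℝ) : ℝ :=
  1 / 2 * arcosh (1 / 2 * (invA w1 w2 w3 w4 uu vv uv - √(invB w1 w2 w3 w4 uu vv uv))) ^ 2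
    + 1 / 2 * arcosh (1 / 2 * (invA w1 w2 w3 w4 uu vv uv + √(invB w1 w2 w3 w4 uu vv uv))) ^ 2

/-- The action of the paint group `SO(2s)` on the solvable coordinates. -/
def paint {s : ℕ} (R : Matrix.specialOrthogonalGroup (Fin (2 * s)) ℝ) (Y : SolvCoord s) :
    SolvCoord s :=
  { Y with x5 := R.1 *ᵥ Y.x5, x6 := R.1 *ᵥ Y.x6 }

end PaintDistance

end

/-!
The distance is computed from two decompositions of `U = SO(2, 2+2s)`.

Iwasawa decomposition. For a symmetric matrix `M = g gᵀ` with `M η M = η`, the last two columns are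
determined by their entries below the second row and one entry of the second row, and the solvable
coordinates can be read off from these (`exists_explicitL_gram`, `last_columns_eq`). Hence every
coset contains exactly one `𝕃(Y)` (`point_bijective`). An orthogonal element of `U` preserves the
splitting into positive and negative directions; that its two diagonal blocks have determinant one
is seen by connectedness: on all of `U` the lower right block in the block-diagonal basis is
invertible, so its determinant stays positive (`hatMat_lower_det_pos`).

Lower bound for the length. If `γ = 𝕃(Y) k` is a `C¹` curve and `V` is its vielbein conjugated by
the compact factor `k`, then the Cartan coordinates satisfy `Y₁' = -V_{NN}` and
`Y₂' = -V_{N-1,N-1}`, while `Tr V² ≥ 2 (V_{NN}² + V_{N-1,N-1}²)` because `V` is symmetric and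
anticommutes with `η`. So a curve is at least `√2` times as long as the change of its Cartan
coordinates (`cartan_le_curveLength`). The one-parameter subgroups of the diagonal matrices attain
this bound, which gives the distance in the maximal flat (`geodDist_flat`).

Cartan decomposition. Conjugation by `diag(K₁, K₂)` with `K₁`, `K₂` orthogonal preserves `U`, its
compact subgroup and the lengths of curves; the determinants of `K₁`, `K₂` play no role, so the
connectedness of `SO(n)` is never needed. A singular value decomposition of the upper right block
moves every point into the maximal flat (`exists_conjSO_eq_flat`). There the Gram matrix becomes
`diag(cosh 2t₀, cosh 2t₁)` and the squared distance from the origin is `2 (t₀² + t₁²)`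
(`exists_gramM_conj`), which is the formula with `arcosh`.

The remaining assertions are matrix identities. For the paint invariants, `2 D Dᵀ - 1` and
`2 Dᵀ D - 1` have the same characteristic polynomial, where `D` is the lower right block of
`hatL W`; the first is the Gram matrix, the second has the entries that occur in `𝔅`
(`lastRow_disc_eq_invB`).
-/

noncomputable section

namespace PaintDistance

variable {s : ℕ}

/-! ### The coset representative and the product law -/

lemma toMat_injective : Function.Injective (toMat : SO0 s → Matrix (IdxT s) (IdxT s) ℝ) :=
  fun _ _ h => Subtype.ext (Subtype.ext (Subtype.ext h))

lemma exp_eq_of_pow_three_eq_zero {n : Type*} [Fintype n] [DecidableEq n] {X : Matrix n n ℝ}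
    (h : X * X * X = 0) : NormedSpace.exp X = 1 + X + (1 / 2 : ℝ) • (X * X) := by
  have h3 : X ^ 3 = 0 := by rw [pow_succ, pow_two, h]
  rw [NormedSpace.exp_eq_tsum ℝ]
  change ∑' k : ℕ, ((k.factorial : ℝ)⁻¹) • X ^ k = _
  rw [tsum_eq_sum (s := Finset.range 3)]
  · simp [Finset.sum_range_succ, pow_two]
  · intro k hk
    have : 3 ≤ k := by simpa using hk
    rw [pow_eq_zero_of_le this h3, smul_zero]

lemma inv_sqrt_two_sq : ((√2)⁻¹ : ℝ) ^ 2 = 1 / 2 := by rw [pow_two, inv_sqrt_two_mul_self]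

lemma exp_cartanPart (Y : SolvCoord s) : NormedSpace.exp (cartanPart Y) =
    Matrix.diagonal (Sum.elim ![Real.exp Y.x1, Real.exp Y.x2]
      (Sum.elim (fun _ => 1) ![Real.exp (-Y.x2), Real.exp (-Y.x1)])) := by
  rw [cartanPart, Matrix.exp_diagonal]
  congr 1
  ext (i | i | i)
  · fin_cases i <;> simp [Pi.coe_exp, Real.exp_eq_exp_ℝ]
  · simp [Pi.coe_exp]
  · fin_cases i <;> simp [Pi.coe_exp, Real.exp_eq_exp_ℝ]

lemma longPart_mul_self (Y : SolvCoord s) : longPart Y * longPart Y =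
    Matrix.fromBlocks 0 (Matrix.fromCols 0 !![0, -(Y.x3 * Y.x4); 0, 0]) 0 0 := by
  ext (i | i | i) (j | j | j) <;> try fin_cases i
  all_goals try fin_cases j
  all_goals simp [longPart, Matrix.mul_apply, Fintype.sum_sum_type]
  all_goals ring_nf
  simp only [inv_sqrt_two_sq]
  ring

lemma shortPart5_mul_self (Y : SolvCoord s) : shortPart5 Y * shortPart5 Y =
    Matrix.fromBlocks 0 (Matrix.fromCols 0 !![0, -(1 / 2 * (Y.x5 ⬝ᵥ Y.x5)); 0, 0]) 0 0 := by
  ext (i | i | i) (j | j | j) <;> try fin_cases i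
  all_goals try fin_cases j
  all_goals simp [shortPart5, Matrix.mul_apply, Fintype.sum_sum_type, dotProduct, Finset.mul_sum]
  refine Finset.sum_congr rfl fun k _ => ?_
  linear_combination Y.x5 k ^ 2 * inv_sqrt_two_sq

lemma shortPart6_mul_self (Y : SolvCoord s) : shortPart6 Y * shortPart6 Y =
    Matrix.fromBlocks 0 (Matrix.fromCols 0 !![0, 0; -(1 / 2 * (Y.x6 ⬝ᵥ Y.x6)), 0]) 0 0 := by
  ext (i | i | i) (j | j | j) <;> try fin_cases i
  all_goals try fin_cases j
  all_goals simp [shortPart6, Matrix.mul_apply, Fintype.sum_sum_type, dotProduct, Finset.mul_sum]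
  refine Finset.sum_congr rfl fun k _ => ?_
  linear_combination Y.x6 k ^ 2 * inv_sqrt_two_sq

lemma exp_longPart (Y : SolvCoord s) : NormedSpace.exp (longPart Y) =
    Matrix.fromBlocks !![1, Y.x3 / √2; 0, 1]
      (Matrix.fromCols 0 !![Y.x4 / √2, -(1 / 2 * (Y.x3 * Y.x4)); 0, -(Y.x4 / √2)])
      0 (Matrix.fromBlocks 1 0 0 !![1, -(Y.x3 / √2); 0, 1]) := by
  rw [exp_eq_of_pow_three_eq_zero, longPart_mul_self]
  · ext (i | i | i) (j | j | j) <;> try fin_cases i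
    all_goals try fin_cases j
    all_goals simp [longPart, Matrix.one_apply]
  · rw [longPart_mul_self]
    ext (i | i | i) (j | j | j) <;> try fin_cases i
    all_goals try fin_cases j
    all_goals simp [longPart, Matrix.mul_apply, Fintype.sum_sum_type]

lemma exp_shortPart5 (Y : SolvCoord s) : NormedSpace.exp (shortPart5 Y) =
    Matrix.fromBlocks 1
      (Matrix.fromCols (Matrix.of ![fun k => Y.x5 k / √2, fun _ => 0])
        !![0, -(1 / 4 * (Y.x5 ⬝ᵥ Y.x5)); 0, 0])
      0 (Matrix.fromBlocks 1 (Matrix.of fun k => ![0, -(Y.x5 k / √2)]) 0 1) := by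
  rw [exp_eq_of_pow_three_eq_zero, shortPart5_mul_self]
  · ext (i | i | i) (j | j | j) <;> try fin_cases i
    all_goals try fin_cases j
    all_goals simp [shortPart5, Matrix.one_apply]
    ring
  · rw [shortPart5_mul_self]
    ext (i | i | i) (j | j | j) <;> try fin_cases i
    all_goals try fin_cases j
    all_goals simp [shortPart5, Matrix.mul_apply, Fintype.sum_sum_type]

lemma exp_shortPart6 (Y : SolvCoord s) : NormedSpace.exp (shortPart6 Y) =
    Matrix.fromBlocks 1
      (Matrix.fromCols (Matrix.of ![fun _ => 0, fun k => Y.x6 k / √2])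
        !![0, 0; -(1 / 4 * (Y.x6 ⬝ᵥ Y.x6)), 0])
      0 (Matrix.fromBlocks 1 (Matrix.of fun k => ![-(Y.x6 k / √2), 0]) 0 1) := by
  rw [exp_eq_of_pow_three_eq_zero, shortPart6_mul_self]
  · ext (i | i | i) (j | j | j) <;> try fin_cases i
    all_goals try fin_cases j
    all_goals simp [shortPart6, Matrix.one_apply]
    ring
  · rw [shortPart6_mul_self]
    ext (i | i | i) (j | j | j) <;> try fin_cases i
    all_goals try fin_cases j
    all_goals simp [shortPart6, Matrix.mul_apply, Fintype.sum_sum_type]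

lemma toMat_cosetRep_eq_exp (Y : SolvCoord s) : toMat (cosetRep Y) =
    NormedSpace.exp (cartanPart Y) * NormedSpace.exp (longPart Y) *
      (NormedSpace.exp (shortPart5 Y) * NormedSpace.exp (shortPart6 Y)) := by
  rw [← Matrix.mul_assoc]; rfl

lemma exp_cartan_mul_exp_long (Y : SolvCoord s) :
    NormedSpace.exp (cartanPart Y) * NormedSpace.exp (longPart Y) =
    Matrix.fromBlocks !![Real.exp Y.x1, Real.exp Y.x1 * (Y.x3 / √2); 0, Real.exp Y.x2]
      (Matrix.fromCols 0 !![Real.exp Y.x1 * (Y.x4 / √2),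
        -(Real.exp Y.x1 * (1 / 2 * (Y.x3 * Y.x4))); 0, -(Real.exp Y.x2 * (Y.x4 / √2))])
      0 (Matrix.fromBlocks 1 0 0
        !![Real.exp (-Y.x2), -(Real.exp (-Y.x2) * (Y.x3 / √2)); 0, Real.exp (-Y.x1)]) := by
  rw [exp_cartanPart, exp_longPart]
  ext (i | i | i) (j | j | j) <;> try fin_cases i
  all_goals try fin_cases j
  all_goals simp [Matrix.diagonal_mul]

lemma exp_short5_mul_exp_short6 (Y : SolvCoord s) :
    NormedSpace.exp (shortPart5 Y) * NormedSpace.exp (shortPart6 Y) =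
    Matrix.fromBlocks 1
      (Matrix.fromCols (Matrix.of ![fun k => Y.x5 k / √2, fun k => Y.x6 k / √2])
        !![-(1 / 2 * (Y.x5 ⬝ᵥ Y.x6)), -(1 / 4 * (Y.x5 ⬝ᵥ Y.x5)); -(1 / 4 * (Y.x6 ⬝ᵥ Y.x6)), 0])
      0 (Matrix.fromBlocks 1 (Matrix.of fun k => ![-(Y.x6 k / √2), -(Y.x5 k / √2)]) 0 1) := by
  rw [exp_shortPart5, exp_shortPart6]
  ext (i | i | i) (j | j | j) <;> try fin_cases i
  all_goals try fin_cases j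
  all_goals simp [Matrix.mul_apply, Fintype.sum_sum_type, Matrix.one_apply, dotProduct,
    Finset.mul_sum]
  refine Finset.sum_congr rfl fun k _ => ?_
  linear_combination Y.x5 k * Y.x6 k * inv_sqrt_two_sq

theorem toMat_cosetRep (Y : SolvCoord s) : toMat (cosetRep Y) = explicitL Y := by
  rw [toMat_cosetRep_eq_exp, exp_cartan_mul_exp_long, exp_short5_mul_exp_short6, explicitL]
  have h2 := inv_sqrt_two_sq
  have h3 : √2 * (√2)⁻¹ = 1 := mul_inv_cancel₀ (by norm_num)
  ext (i | i | i) (j | j | j) <;> try fin_cases i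
  all_goals try fin_cases j
  all_goals simp [Matrix.mul_apply, Fintype.sum_sum_type, Matrix.one_apply]
  all_goals try ring_nf
  have h4 : √2 = 2 * (√2)⁻¹ := by linear_combination √2 * (-2) * h2 + 2 * (√2)⁻¹ * h3
  linear_combination Real.exp Y.x1 * Y.x3 * Y.x6 j * h2 - 1 / 2 * Real.exp Y.x1 * Y.x5 j * h4

lemma blockTriangular_mul {l m n : Type*} [Fintype l] [Fintype m] [Fintype n] [DecidableEq m]
    (A A' : Matrix l l ℝ) (B B' : Matrix l m ℝ)
    (C C' : Matrix l n ℝ) (E E' : Matrix m n ℝ) (F F' : Matrix n n ℝ) :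
    fromBlocks A (fromCols B C) 0 (fromBlocks 1 E 0 F) *
      fromBlocks A' (fromCols B' C') 0 (fromBlocks 1 E' 0 F') =
    fromBlocks (A * A') (fromCols (A * B' + B) (A * C' + (B * E' + C * F'))) 0
      (fromBlocks 1 (E' + E * F') 0 (F * F')) := by
  ext (i | i | i) (j | j | j) <;>
    simp [Matrix.mul_apply, Fintype.sum_sum_type, Matrix.one_apply]

lemma shortRows_mul_shortCols (U W : SolvCoord s) :
    (Matrix.of ![fun k => 1 / 2 * Real.exp U.x1 * (√2 * U.x5 k + U.x3 * U.x6 k),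
        fun k => Real.exp U.x2 / √2 * U.x6 k] : Matrix (Fin 2) (Fin (2 * s)) ℝ) *
      (Matrix.of fun k => ![-(1 / √2) * W.x6 k, -(1 / √2) * W.x5 k]) =
    !![-(1 / √2) * (1 / 2 * Real.exp U.x1 * (√2 * (U.x5 ⬝ᵥ W.x6) + U.x3 * (U.x6 ⬝ᵥ W.x6))),
       -(1 / √2) * (1 / 2 * Real.exp U.x1 * (√2 * (U.x5 ⬝ᵥ W.x5) + U.x3 * (U.x6 ⬝ᵥ W.x5)));
       -(1 / √2) * (Real.exp U.x2 / √2 * (U.x6 ⬝ᵥ W.x6)),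
       -(1 / √2) * (Real.exp U.x2 / √2 * (U.x6 ⬝ᵥ W.x5))] := by
  ext i j
  rw [Matrix.mul_apply]
  fin_cases i <;> fin_cases j <;>
    simp only [dotProduct, Finset.mul_sum, ← Finset.sum_add_distrib, Matrix.of_apply,
      Matrix.cons_val_zero, Matrix.cons_val_one, Fin.zero_eta, Fin.mk_one] <;>
    exact Finset.sum_congr rfl fun k _ => by ring

lemma explicitL_mul_explicitL_quotCoord (U V : SolvCoord s) :
    explicitL U * explicitL (quotCoord U V) = explicitL V := by
  have hs : √2 ≠ 0 := by norm_num
  have hs2 : √2 ^ 2 = 2 := by norm_num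
  have hs3 : √2 ^ 3 = 2 * √2 := by rw [pow_succ, hs2]
  have hs4 : √2 ^ 4 = 4 := by rw [pow_succ, hs3, mul_assoc, ← pow_two, hs2]; norm_num
  have hs5 : √2 ^ 5 = 4 * √2 := by rw [pow_succ, hs4]
  have h5 := dotProduct_comm V.x5 U.x5
  have h6 := dotProduct_comm V.x6 U.x6
  have h56 := dotProduct_comm V.x5 U.x6
  have h66 := dotProduct_comm U.x6 U.x5
  rw [explicitL, explicitL, explicitL, blockTriangular_mul]
  congr 1
  · ext i j; fin_cases i <;> fin_cases j <;> simp [quotCoord, Real.exp_add, Real.exp_sub]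
    all_goals field_simp
    all_goals ring
  · congr 1
    · ext i j; fin_cases i <;> simp [quotCoord, Real.exp_add, Real.exp_sub]
      all_goals field_simp
      all_goals ring_nf
      all_goals simp only [hs2, hs3, hs4]
      all_goals ring
    · rw [shortRows_mul_shortCols]
      ext i j; fin_cases i <;> fin_cases j <;>
        simp [quotCoord, Real.exp_add, Real.exp_sub, two_mul,
          dotProduct_add, dotProduct_sub, add_dotProduct, sub_dotProduct, h5, h6, h56, h66]
      all_goals field_simp
      all_goals ring_nf
      all_goals try simp only [hs2, hs3, hs4, hs5]
      all_goals ring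
  · congr 1
    · ext i j; fin_cases j <;>
        simp [quotCoord, Real.exp_add, Real.exp_sub, Matrix.mul_apply]
      all_goals field_simp
      all_goals ring_nf
      all_goals simp only [hs2]
      all_goals ring
    · ext i j
      fin_cases i <;> fin_cases j <;>
        simp [quotCoord, Real.exp_add, Real.exp_sub, Real.exp_neg]
      all_goals field_simp
      all_goals ring
theorem inv_cosetRep_mul_cosetRep (U V : SolvCoord s) :
    (cosetRep U)⁻¹ * cosetRep V = cosetRep (quotCoord U V) := by
  rw [inv_mul_eq_iff_eq_mul]
  apply toMat_injective
  rw [toMat_mul, toMat_cosetRep, toMat_cosetRep, toMat_cosetRep,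
    explicitL_mul_explicitL_quotCoord]

/-! ### The last two rows and the invariants -/

lemma Omega_mul_apply_inr {n : Type*} (A : Matrix (IdxT s) n ℝ) (a : Fin 2) (j : n) :
    (Omega s * A) (.inr a) j = (√2)⁻¹ * (A (.inl a) j - A (.inr (.inr a.rev)) j) := by
  simp [Matrix.mul_apply, Fintype.sum_sum_type, Omega]; ring

lemma Omega_mul_apply_inl_inr {n : Type*} (A : Matrix (IdxT s) n ℝ) (a : Fin 2) (j : n) :
    (Omega s * A) (.inl (.inr a)) j = (√2)⁻¹ * (A (.inl a) j + A (.inr (.inr a.rev)) j) := by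
  simp [Matrix.mul_apply, Fintype.sum_sum_type, Omega]; ring

lemma Omega_mul_apply_inl_inl {n : Type*} (A : Matrix (IdxT s) n ℝ) (k : Fin (2 * s)) (j : n) :
    (Omega s * A) (.inl (.inl k)) j = A (.inr (.inl k)) j := by
  simp [Matrix.mul_apply, Fintype.sum_sum_type, Omega]

lemma mul_Omega_transpose_apply {n : Type*} (A : Matrix n (IdxT s) ℝ) (i : n) (j : IdxB s) :
    (A * (Omega s)ᵀ) i j = (Omega s * Aᵀ) j i := by
  rw [← Matrix.transpose_apply (A * (Omega s)ᵀ), Matrix.transpose_mul, Matrix.transpose_transpose]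

lemma lastRow_zero (W : SolvCoord s) : lastRow W 0 = explicitRow1 W := by
  have hs2 : √2 ^ 2 = 2 := by norm_num
  have hs3 : √2 ^ 3 = 2 * √2 := by rw [pow_succ, hs2]
  have hs4 : √2 ^ 4 = 4 := by rw [pow_succ, hs3, mul_assoc, ← pow_two, hs2]; norm_num
  ext ((j | j) | j) <;> try fin_cases j
  all_goals simp only [lastRow, hatL, mul_Omega_transpose_apply, Omega_mul_apply_inr,
      Omega_mul_apply_inl_inr, Omega_mul_apply_inl_inl, toMat_cosetRep, Matrix.transpose_apply]
  all_goals simp [explicitL, explicitRow1, Fin.rev, two_mul, Real.exp_add, Real.exp_neg]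
  all_goals field_simp
  all_goals try ring_nf
  all_goals try simp only [hs2, hs3, hs4]
  all_goals try ring

lemma lastRow_one (W : SolvCoord s) : lastRow W 1 = explicitRow2 W := by
  have hs2 : √2 ^ 2 = 2 := by norm_num
  ext ((j | j) | j) <;> try fin_cases j
  all_goals simp only [lastRow, hatL, mul_Omega_transpose_apply, Omega_mul_apply_inr,
      Omega_mul_apply_inl_inr, Omega_mul_apply_inl_inl, toMat_cosetRep, Matrix.transpose_apply]
  all_goals simp [explicitL, explicitRow2, Fin.rev, two_mul, Real.exp_add, Real.exp_neg]
  all_goals field_simp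
  all_goals try ring_nf
  all_goals try simp only [hs2]
  all_goals try ring

lemma harmonicM_toBlocks (W : SolvCoord s) : (harmonicM W).toBlocks₂₂ = gramM W := by
  have h : harmonicM W = hatL W * (hatL W)ᵀ := by
    rw [harmonicM, hatL]
    calc _ = Omega s * toMat (cosetRep W) * ((Omega s)ᵀ * Omega s) *
          (toMat (cosetRep W))ᵀ * (Omega s)ᵀ := by
          rw [Omega_transpose_mul, Matrix.mul_one]; simp only [Matrix.mul_assoc]
      _ = _ := by simp only [Matrix.transpose_mul, Matrix.transpose_transpose, Matrix.mul_assoc]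
  ext a b
  rw [h]
  rfl

lemma lambda_add (W : SolvCoord s) : (gramM W).trace = lambdaPlus W + lambdaMinus W := by
  simp only [Matrix.trace_fin_two, gramM, Matrix.of_apply, lambdaPlus, lambdaMinus]; ring

lemma lambda_mul (W : SolvCoord s) : (gramM W).det = lambdaPlus W * lambdaMinus W := by
  have hsq := Real.sq_sqrt (show 0 ≤ (lastRow W 0 ⬝ᵥ lastRow W 0 - lastRow W 1 ⬝ᵥ lastRow W 1) ^ 2
      + 4 * (lastRow W 0 ⬝ᵥ lastRow W 1) ^ 2 by positivity)
  simp only [Matrix.det_fin_two, gramM, Matrix.of_apply, lambdaPlus, lambdaMinus,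
    dotProduct_comm (lastRow W 1) (lastRow W 0)]
  linear_combination (1 / 4 : ℝ) * hsq

lemma gramM_charpoly (W : SolvCoord s) : (gramM W).charpoly =
    (Polynomial.X - Polynomial.C (lambdaPlus W)) *
      (Polynomial.X - Polynomial.C (lambdaMinus W)) := by
  rw [Matrix.charpoly_fin_two, lambda_add, lambda_mul, Polynomial.C_add, Polynomial.C_mul]
  ring

/-! ### The block-diagonal basis -/

/-- The invariant form in the block-diagonal basis, `diag(1, …, 1, -1, -1)`. -/
def etaB (s : ℕ) : Matrix (IdxB s) (IdxB s) ℝ := Matrix.fromBlocks 1 0 0 (-1)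

lemma Omega_mul_etaT (s : ℕ) : Omega s * etaT s = etaB s * Omega s := by
  have hB : ∀ i j, (etaB s * Omega s) (.inr i) j = -Omega s (.inr i) j := fun i j => by
    simp [etaB, Matrix.mul_apply, Fintype.sum_sum_type, Matrix.one_apply]
  have hA : ∀ i j, (etaB s * Omega s) (.inl i) j = Omega s (.inl i) j := fun i j => by
    simp [etaB, Matrix.mul_apply, Fintype.sum_sum_type, Matrix.one_apply]
  ext ((i | i) | i) (j | j | j)
  all_goals simp only [hA, hB, Omega_mul_apply_inr, Omega_mul_apply_inl_inr,
    Omega_mul_apply_inl_inl]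
  all_goals simp [etaT, Omega]
  split_ifs <;> simp

lemma toMat_transpose_mul_etaT_mul (g : SO0 s) : (toMat g)ᵀ * etaT s * toMat g = etaT s := g.1.2

lemma toMat_mul_toMat_inv (g : SO0 s) : toMat g * toMat g⁻¹ = 1 := by
  rw [← toMat_mul, mul_inv_cancel, toMat_one]

lemma toMat_inv_mul_toMat (g : SO0 s) : toMat g⁻¹ * toMat g = 1 := by
  rw [← toMat_mul, inv_mul_cancel, toMat_one]

lemma toMat_inv (g : SO0 s) : toMat g⁻¹ = etaT s * (toMat g)ᵀ * etaT s := by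
  have h : etaT s * (toMat g)ᵀ * etaT s * toMat g = 1 := by
    rw [Matrix.mul_assoc (etaT s), Matrix.mul_assoc (etaT s), toMat_transpose_mul_etaT_mul,
      etaT_mul_self]
  rw [← Matrix.mul_one (etaT s * (toMat g)ᵀ * etaT s), ← toMat_mul_toMat_inv g,
    ← Matrix.mul_assoc, h, Matrix.one_mul]

lemma toMat_mul_etaT_mul_transpose (g : SO0 s) : toMat g * etaT s * (toMat g)ᵀ = etaT s := by
  have h := toMat_mul_toMat_inv g
  rw [toMat_inv, ← Matrix.mul_assoc, ← Matrix.mul_assoc] at h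
  rw [← Matrix.mul_one (toMat g * etaT s * (toMat g)ᵀ), ← etaT_mul_self, ← Matrix.mul_assoc, h,
    Matrix.one_mul]

/-- The matrix of a group element in the block-diagonal basis. -/
def hatMat (g : SO0 s) : Matrix (IdxB s) (IdxB s) ℝ := Omega s * toMat g * (Omega s)ᵀ

lemma Omega_conj_mul (A B : Matrix (IdxT s) (IdxT s) ℝ) :
    Omega s * A * (Omega s)ᵀ * (Omega s * B * (Omega s)ᵀ) = Omega s * (A * B) * (Omega s)ᵀ := by
  calc _ = Omega s * A * ((Omega s)ᵀ * Omega s) * B * (Omega s)ᵀ := by simp only [Matrix.mul_assoc]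
    _ = _ := by rw [Omega_transpose_mul, Matrix.mul_one]; simp only [Matrix.mul_assoc]

lemma Omega_conj_transpose (A : Matrix (IdxT s) (IdxT s) ℝ) :
    (Omega s * A * (Omega s)ᵀ)ᵀ = Omega s * Aᵀ * (Omega s)ᵀ := by
  simp only [Matrix.transpose_mul, Matrix.transpose_transpose, Matrix.mul_assoc]

lemma Omega_conj_etaT (s : ℕ) : Omega s * etaT s * (Omega s)ᵀ = etaB s := by
  rw [Omega_mul_etaT, Matrix.mul_assoc, Omega_mul_transpose, Matrix.mul_one]

lemma hatMat_transpose_mul_etaB_mul (g : SO0 s) : (hatMat g)ᵀ * etaB s * hatMat g = etaB s := by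
  rw [← Omega_conj_etaT, hatMat, Omega_conj_transpose, Omega_conj_mul, Omega_conj_mul,
    toMat_transpose_mul_etaT_mul]

lemma hatMat_mul_etaB_mul_transpose (g : SO0 s) : hatMat g * etaB s * (hatMat g)ᵀ = etaB s := by
  rw [← Omega_conj_etaT, hatMat, Omega_conj_transpose, Omega_conj_mul, Omega_conj_mul,
    toMat_mul_etaT_mul_transpose]

lemma fromBlocks_relations_of_etaB {A : Matrix (Fin (2 * s) ⊕ Fin 2) (Fin (2 * s) ⊕ Fin 2) ℝ}
    {B C D} (h : Matrix.fromBlocks A B C D * etaB s * (Matrix.fromBlocks A B C D)ᵀ = etaB s) :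
    A * Aᵀ = 1 + B * Bᵀ ∧ A * Cᵀ = B * Dᵀ ∧ D * Dᵀ = 1 + C * Cᵀ := by
  rw [etaB, Matrix.fromBlocks_transpose, Matrix.fromBlocks_multiply, Matrix.fromBlocks_multiply,
    Matrix.fromBlocks_inj] at h
  obtain ⟨h1, h2, -, h4⟩ := h
  simp only [Matrix.mul_one, Matrix.mul_zero, add_zero, zero_add, Matrix.mul_neg,
    Matrix.neg_mul] at h1 h2 h4
  refine ⟨?_, ?_, ?_⟩
  · rw [← h1]; abel
  · rw [← sub_eq_zero, sub_eq_add_neg, h2]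
  · rw [← neg_neg (D * Dᵀ), ← sub_eq_iff_eq_add', ← sub_eq_zero, ← neg_eq_zero, ← sub_eq_zero.2 h4]
    abel

lemma hatMat_lower_gram (g : SO0 s) : (hatMat g).toBlocks₂₂ * ((hatMat g).toBlocks₂₂)ᵀ =
    1 + (hatMat g).toBlocks₂₁ * ((hatMat g).toBlocks₂₁)ᵀ := by
  have h := hatMat_mul_etaB_mul_transpose g
  rw [← Matrix.fromBlocks_toBlocks (hatMat g)] at h
  exact (fromBlocks_relations_of_etaB h).2.2

lemma lastRow_dotProduct (W : SolvCoord s) (a b : Fin 2) : lastRow W a ⬝ᵥ lastRow W b =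
    2 * (lastRow W a (.inr 0) * lastRow W b (.inr 0) + lastRow W a (.inr 1) * lastRow W b (.inr 1))
      - (1 : Matrix (Fin 2) (Fin 2) ℝ) a b := by
  have h := congrFun (congrFun (hatMat_lower_gram (cosetRep W)) a) b
  simp only [Matrix.mul_apply, Matrix.add_apply, Matrix.toBlocks₂₂, Matrix.toBlocks₂₁,
    Matrix.of_apply, Matrix.transpose_apply, Fin.sum_univ_two] at h
  have h' : lastRow W a ⬝ᵥ lastRow W b = ∑ j, hatMat (cosetRep W) (.inr a) (.inl j) *
      hatMat (cosetRep W) (.inr b) (.inl j) + (lastRow W a (.inr 0) * lastRow W b (.inr 0)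
        + lastRow W a (.inr 1) * lastRow W b (.inr 1)) := by
    rw [dotProduct, Fintype.sum_sum_type, Fin.sum_univ_two]; rfl
  change lastRow W a (.inr 0) * lastRow W b (.inr 0) + lastRow W a (.inr 1) * lastRow W b (.inr 1)
    = _ at h
  linarith

/-- The invariant `𝔄` is the trace of the Gram matrix. -/
lemma lastRow_sum_eq_invA (W : SolvCoord s) :
    lastRow W 0 ⬝ᵥ lastRow W 0 + lastRow W 1 ⬝ᵥ lastRow W 1 =
      invA W.x1 W.x2 W.x3 W.x4 (W.x5 ⬝ᵥ W.x5) (W.x6 ⬝ᵥ W.x6) (W.x5 ⬝ᵥ W.x6) := by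
  have hs2 : √2 ^ 2 = 2 := by norm_num
  have hs3 : √2 ^ 3 = 2 * √2 := by rw [pow_succ, hs2]
  have hs4 : √2 ^ 4 = 4 := by rw [pow_succ, hs3, mul_assoc, ← pow_two, hs2]; norm_num
  rw [lastRow_dotProduct, lastRow_dotProduct, lastRow_zero, lastRow_one]
  simp only [explicitRow1, explicitRow2, invA, Sum.elim_inr, Matrix.cons_val_zero,
    Matrix.cons_val_one, Matrix.one_apply_eq, Real.sinh_eq, Real.cosh_eq, two_mul, Real.exp_add,
      Real.exp_neg, neg_mul]
  field_simp
  ring_nf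
  simp only [hs2, hs3, hs4]
  ring

/-- The invariant `𝔅` is the discriminant of the Gram matrix. With `D` the lower right block of
`hatL W`, the Gram matrix is `2 D Dᵀ - 1`, and `𝔅` is the discriminant in terms of the entries of
`2 Dᵀ D - 1`, which has the same characteristic polynomial. -/
lemma lastRow_disc_eq_invB (W : SolvCoord s) :
    (lastRow W 0 ⬝ᵥ lastRow W 0 - lastRow W 1 ⬝ᵥ lastRow W 1) ^ 2
      + 4 * (lastRow W 0 ⬝ᵥ lastRow W 1) ^ 2 =
      invB W.x1 W.x2 W.x3 W.x4 (W.x5 ⬝ᵥ W.x5) (W.x6 ⬝ᵥ W.x6) (W.x5 ⬝ᵥ W.x6) := by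
  have hs2 : √2 ^ 2 = 2 := by norm_num
  have hs3 : √2 ^ 3 = 2 * √2 := by rw [pow_succ, hs2]
  have hs4 : √2 ^ 4 = 4 := by rw [pow_succ, hs3, mul_assoc, ← pow_two, hs2]; norm_num
  rw [lastRow_dotProduct, lastRow_dotProduct, lastRow_dotProduct]
  set p := lastRow W 0 (.inr 0) with hp
  set q := lastRow W 0 (.inr 1) with hq
  set r := lastRow W 1 (.inr 0) with hr
  set t := lastRow W 1 (.inr 1) with ht
  trans 4 * (p ^ 2 + r ^ 2 - q ^ 2 - t ^ 2) ^ 2 + 16 * (p * q + r * t) ^ 2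
  · simp; ring
  rw [lastRow_zero] at hp hq
  rw [lastRow_one] at hr ht
  simp only [explicitRow1, explicitRow2, Sum.elim_inr, Matrix.cons_val_zero,
    Matrix.cons_val_one, two_mul, Real.exp_add, Real.exp_neg, neg_mul] at hp hq hr ht
  rw [invB]
  have e1 : 2 * (p ^ 2 + r ^ 2 - q ^ 2 - t ^ 2) = - (1 / 128) *
      (32 * (W.x6 ⬝ᵥ W.x6)
        - 4 * Real.exp (2 * W.x1) * ((W.x5 ⬝ᵥ W.x5) + 2 * W.x3 * W.x4 + 4) ^ 2
        - 32 * ((W.x5 ⬝ᵥ W.x5) + Real.exp (-2 * W.x2) * W.x3 ^ 2 + Real.exp (2 * W.x2) * W.x4 ^ 2)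
        + Real.exp (2 * W.x1) *
          (4 * (W.x5 ⬝ᵥ W.x6) + √2 * (((W.x6 ⬝ᵥ W.x6) + 4) * W.x3 - 4 * W.x4)) ^ 2
        + 2 * ((W.x6 ⬝ᵥ W.x6) * Real.exp W.x2 + 8 * Real.sinh W.x2) ^ 2
        + 2 * ((W.x6 ⬝ᵥ W.x6) * Real.sinh W.x2 + ((W.x6 ⬝ᵥ W.x6) + 8) * Real.cosh W.x2) ^ 2
        - 64 * Real.exp (-2 * W.x1)) := by
    simp only [hp, hq, hr, ht, Real.sinh_eq, Real.cosh_eq, two_mul, Real.exp_add,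
      Real.exp_neg, neg_mul]
    field_simp
    ring_nf
    simp only [hs2, hs3, hs4]
    ring
  have e2 : 4 * (p * q + r * t) = 4 / 128 * Real.exp (-2 * W.x2) *
      (Real.exp (2 * (W.x1 + W.x2)) * ((W.x5 ⬝ᵥ W.x5) + 2 * W.x3 * W.x4 + 4)
          * (4 * (W.x5 ⬝ᵥ W.x6) + √2 * (((W.x6 ⬝ᵥ W.x6) + 4) * W.x3 - 4 * W.x4))
        + 4 * (4 * (W.x5 ⬝ᵥ W.x6) * Real.exp (2 * W.x2) +
            √2 * ((W.x6 ⬝ᵥ W.x6) + 4) * Real.exp (4 * W.x2) * W.x4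
          - 4 * √2 * W.x3)) := by
    have : (4 : ℝ) * W.x2 = W.x2 + W.x2 + (W.x2 + W.x2) := by ring
    simp only [hp, hq, hr, ht, this, two_mul, Real.exp_add,
      Real.exp_neg, neg_mul]
    field_simp
    ring_nf
    simp only [hs2]
    ring
  have e3 : Real.exp (-4 * W.x2) = Real.exp (-2 * W.x2) ^ 2 := by
    rw [← Real.exp_nat_mul]; congr 1; push_cast; ring
  calc _ = (2 * (p ^ 2 + r ^ 2 - q ^ 2 - t ^ 2)) ^ 2 + (4 * (p * q + r * t)) ^ 2 := by ring
    _ = _ := by rw [e1, e2, e3]; ring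

/-! ### The maximal compact subgroup and the Iwasawa decomposition -/

lemma hatMat_mul (g h : SO0 s) : hatMat (g * h) = hatMat g * hatMat h := by
  rw [hatMat, hatMat, hatMat, Omega_conj_mul, toMat_mul]

lemma hatMat_one : hatMat (1 : SO0 s) = 1 := by
  rw [hatMat, toMat_one, Matrix.mul_one, Omega_mul_transpose]

lemma det_toMat (g : SO0 s) : (toMat g).det = 1 := g.1.1.2

lemma det_hatMat (g : SO0 s) : (hatMat g).det = 1 := by
  rw [hatMat, Matrix.det_conj_of_mul_eq_one (Omega_mul_transpose s) (Omega_transpose_mul s),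
    det_toMat]

lemma hatMat_lower_det_ne_zero (g : SO0 s) : (hatMat g).toBlocks₂₂.det ≠ 0 := by
  have h := congrArg Matrix.det (hatMat_lower_gram g)
  rw [Matrix.det_mul, Matrix.det_transpose] at h
  have hp : 0 < (1 + (hatMat g).toBlocks₂₁ * ((hatMat g).toBlocks₂₁)ᵀ).det :=
    (Matrix.PosDef.one.add_posSemidef
      (Matrix.posSemidef_self_mul_conjTranspose (hatMat g).toBlocks₂₁)).det_pos
  intro h0
  rw [h0] at h
  simp only [mul_zero] at h
  exact hp.ne h

/-- On the identity component the determinant of the lower right block cannot change sign. -/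
lemma hatMat_lower_det_pos (g : SO0 s) : 0 < (hatMat g).toBlocks₂₂.det := by
  let f : pseudoSO s → ℝ := fun x => (Omega s * x.1.1 * (Omega s)ᵀ).toBlocks₂₂.det
  have hf : Continuous f := by
    refine Continuous.matrix_det ?_
    refine Continuous.matrix_submatrix (A := fun x : pseudoSO s =>
      Omega s * x.1.1 * (Omega s)ᵀ) ?_ Sum.inr Sum.inr
    have hv : Continuous fun x : pseudoSO s => x.1.1 :=
      Continuous.comp (g := fun x : Matrix.SpecialLinearGroup (IdxT s) ℝ => x.1)
        (f := fun x : pseudoSO s => x.1) continuous_subtype_val continuous_subtype_val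
    exact (continuous_const.matrix_mul hv).matrix_mul continuous_const
  have hc : IsPreconnected (f '' connectedComponent (1 : pseudoSO s)) :=
    isPreconnected_connectedComponent.image f hf.continuousOn
  have h1 : (1 : ℝ) ∈ f '' connectedComponent (1 : pseudoSO s) := by
    refine ⟨1, mem_connectedComponent, ?_⟩
    change (hatMat (1 : SO0 s)).toBlocks₂₂.det = 1
    rw [hatMat_one, ← Matrix.fromBlocks_one, Matrix.toBlocks_fromBlocks₂₂, Matrix.det_one]
  have hg : (hatMat g).toBlocks₂₂.det ∈ f '' connectedComponent (1 : pseudoSO s) :=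
    ⟨g.1, g.2, rfl⟩
  by_contra hneg
  obtain ⟨x, hx, hx0⟩ := hc.ordConnected.out hg h1 ⟨not_lt.1 hneg, zero_le_one⟩
  exact hatMat_lower_det_ne_zero ⟨x, hx⟩ hx0

lemma mem_Hc_of_fromBlocks {g : SO0 s} {A D} (h : hatMat g = Matrix.fromBlocks A 0 0 D)
    (hA : A * Aᵀ = 1) (hD : D * Dᵀ = 1) : g ∈ Hc s := by
  have hdet := det_hatMat g
  have hpos := hatMat_lower_det_pos g
  rw [h, Matrix.det_fromBlocks_zero₂₁] at hdet
  rw [h, Matrix.toBlocks_fromBlocks₂₂] at hpos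
  have hD2 := congrArg Matrix.det hD
  rw [Matrix.det_mul, Matrix.det_transpose, Matrix.det_one] at hD2
  have hD1 : D.det = 1 := by nlinarith
  have hA1 : A.det = 1 := by rwa [hD1, mul_one] at hdet
  refine ⟨A, ?_, D, ?_, h⟩
  · exact Matrix.mem_specialOrthogonalGroup_iff.2
      ⟨(Matrix.mem_orthogonalGroup_iff _ _).2 hA, hA1⟩
  · exact Matrix.mem_specialOrthogonalGroup_iff.2
      ⟨(Matrix.mem_orthogonalGroup_iff _ _).2 hD, hD1⟩

lemma mem_Hc_of_lower_left_eq_zero {g : SO0 s} (h : (hatMat g).toBlocks₂₁ = 0) : g ∈ Hc s := by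
  have hrel := hatMat_mul_etaB_mul_transpose g
  have hb := Matrix.fromBlocks_toBlocks (hatMat g)
  rw [← hb] at hrel
  obtain ⟨h1, h2, h3⟩ := fromBlocks_relations_of_etaB hrel
  rw [h] at h2 h3
  simp only [Matrix.transpose_zero, Matrix.mul_zero, add_zero] at h2 h3
  have hB : (hatMat g).toBlocks₁₂ = 0 := by
    rw [← Matrix.mul_one (hatMat g).toBlocks₁₂, ← mul_eq_one_comm.1 h3, ← Matrix.mul_assoc,
      ← h2, Matrix.zero_mul]
  rw [hB] at h1
  simp only [Matrix.transpose_zero, Matrix.mul_zero, add_zero] at h1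
  exact mem_Hc_of_fromBlocks (by rw [← hb, hB, h]; simp) h1 h3

lemma mem_Hc_of_upper_right_eq_zero {g : SO0 s} (h : (hatMat g).toBlocks₁₂ = 0) : g ∈ Hc s := by
  have hrel := hatMat_mul_etaB_mul_transpose g
  rw [← Matrix.fromBlocks_toBlocks (hatMat g)] at hrel
  obtain ⟨h1, h2, -⟩ := fromBlocks_relations_of_etaB hrel
  rw [h] at h1 h2
  simp only [Matrix.zero_mul, add_zero] at h1 h2
  apply mem_Hc_of_lower_left_eq_zero
  rw [← Matrix.transpose_inj, Matrix.transpose_zero,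
    ← Matrix.one_mul ((hatMat g).toBlocks₂₁)ᵀ, ← mul_eq_one_comm.1 h1, Matrix.mul_assoc,
    h2, Matrix.mul_zero]

/-- If the lower right block of `g gᵀ` in the block-diagonal basis is the identity, then `g` lies in
the compact subgroup: `D Dᵀ = 1 + C Cᵀ` then forces `C = 0`. -/
lemma mem_Hc_of_lower_gram_eq_one {g : SO0 s} (h : (hatMat g * (hatMat g)ᵀ).toBlocks₂₂ = 1) :
    g ∈ Hc s := by
  have h1 := hatMat_lower_gram g
  rw [← Matrix.fromBlocks_toBlocks (hatMat g), Matrix.fromBlocks_transpose,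
    Matrix.fromBlocks_multiply, Matrix.toBlocks_fromBlocks₂₂, h1] at h
  apply mem_Hc_of_lower_left_eq_zero
  set C := (hatMat g).toBlocks₂₁
  have h2 : C * Cᵀ = 0 := by
    have h3 : (2 : ℝ) • (C * Cᵀ) = 0 := by
      rw [two_smul, ← sub_eq_zero.2 h]; abel
    exact (smul_eq_zero.1 h3).resolve_left two_ne_zero
  exact Matrix.self_mul_conjTranspose_eq_zero.1 h2

lemma toMat_mul_transpose_of_mem_Hc {h : SO0 s} (hh : h ∈ Hc s) :
    toMat h * (toMat h)ᵀ = 1 := by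
  obtain ⟨A, hA, B, hB, hAB⟩ := hh
  have hA1 : A * Aᵀ = 1 := (Matrix.mem_orthogonalGroup_iff _ _).1 hA.1
  have hB1 : B * Bᵀ = 1 := (Matrix.mem_orthogonalGroup_iff _ _).1 hB.1
  have h1 : Omega s * (toMat h * (toMat h)ᵀ) * (Omega s)ᵀ = 1 := by
    rw [← Omega_conj_mul, ← Omega_conj_transpose, hAB, Matrix.fromBlocks_transpose,
      Matrix.fromBlocks_multiply, hA1, hB1]
    simp
  calc toMat h * (toMat h)ᵀ
      = (Omega s)ᵀ * Omega s * (toMat h * (toMat h)ᵀ) * ((Omega s)ᵀ * Omega s) := by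
        rw [Omega_transpose_mul, Matrix.one_mul, Matrix.mul_one]
    _ = (Omega s)ᵀ * (Omega s * (toMat h * (toMat h)ᵀ) * (Omega s)ᵀ) * Omega s := by
        simp only [Matrix.mul_assoc]
    _ = 1 := by rw [h1, Matrix.mul_one, Omega_transpose_mul]

lemma mul_etaT_mul_apply_last {M : Matrix (IdxT s) (IdxT s) ℝ} (hs : Mᵀ = M)
    (hM : M * etaT s * M = etaT s) (a b : Fin 2) :
    M (.inl 0) (.inr (.inr a)) * M (.inr (.inr 1)) (.inr (.inr b)) +
      M (.inl 1) (.inr (.inr a)) * M (.inr (.inr 0)) (.inr (.inr b)) +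
      ∑ k, M (.inr (.inl k)) (.inr (.inr a)) * M (.inr (.inl k)) (.inr (.inr b)) +
      M (.inr (.inr 0)) (.inr (.inr a)) * M (.inl 1) (.inr (.inr b)) +
      M (.inr (.inr 1)) (.inr (.inr a)) * M (.inl 0) (.inr (.inr b)) = 0 := by
  have h := congrFun (congrFun hM (.inr (.inr a))) (.inr (.inr b))
  have hsym : ∀ i j, M i j = M j i := fun i j => congrFun (congrFun hs j) i
  rw [Matrix.mul_apply, Fintype.sum_sum_type, Fintype.sum_sum_type, Fin.sum_univ_two,
    Fin.sum_univ_two] at h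
  simp only [mul_etaT_apply_inl, mul_etaT_apply_mid, mul_etaT_apply_inr] at h
  have h0 : etaT s (.inr (.inr a)) (.inr (.inr b)) = 0 := rfl
  rw [h0] at h
  have hr0 : (0 : Fin 2).rev = 1 := rfl
  have hr1 : (1 : Fin 2).rev = 0 := rfl
  rw [hr0, hr1] at h
  simp only [hsym (.inr (.inr a))] at h
  linarith

/-- A symmetric matrix in `SO(η)` has its last two columns determined by the entries of these
columns below the second row, together with one entry of the second row. -/
lemma last_columns_eq {M P : Matrix (IdxT s) (IdxT s) ℝ} (hMs : Mᵀ = M) (hPs : Pᵀ = P)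
    (hM : M * etaT s * M = etaT s) (hP : P * etaT s * P = etaT s)
    (h1 : M (.inr (.inr 1)) (.inr (.inr 1)) ≠ 0)
    (h2 : M (.inr (.inr 1)) (.inr (.inr 1)) * M (.inr (.inr 0)) (.inr (.inr 0)) -
      M (.inr (.inr 0)) (.inr (.inr 1)) ^ 2 ≠ 0)
    (hlow : ∀ i b, P (.inr i) (.inr (.inr b)) = M (.inr i) (.inr (.inr b)))
    (hent : P (.inl 1) (.inr (.inr 1)) = M (.inl 1) (.inr (.inr 1))) (i : IdxT s) (b : Fin 2) :
    P i (.inr (.inr b)) = M i (.inr (.inr b)) := by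
  have e11 := mul_etaT_mul_apply_last hMs hM 1 1
  have e01 := mul_etaT_mul_apply_last hMs hM 0 1
  have e00 := mul_etaT_mul_apply_last hMs hM 0 0
  have f11 := mul_etaT_mul_apply_last hPs hP 1 1
  have f01 := mul_etaT_mul_apply_last hPs hP 0 1
  have f00 := mul_etaT_mul_apply_last hPs hP 0 0
  have hsym : M (.inr (.inr 1)) (.inr (.inr 0)) = M (.inr (.inr 0)) (.inr (.inr 1)) :=
    congrFun (congrFun hMs (.inr (.inr 0))) (.inr (.inr 1))
  simp only [hlow, hent, hsym] at e11 e01 e00 f11 f01 f00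
  have k1 : P (.inl 0) (.inr (.inr 1)) = M (.inl 0) (.inr (.inr 1)) := by
    apply mul_right_cancel₀ h1; linarith
  rw [k1] at f01
  have k2 : P (.inl 1) (.inr (.inr 0)) = M (.inl 1) (.inr (.inr 0)) := by
    apply mul_right_cancel₀ h2
    linear_combination M (.inr (.inr 1)) (.inr (.inr 1)) * (f00 - e00) / 2
      - M (.inr (.inr 0)) (.inr (.inr 1)) * (f01 - e01)
  have k3 : P (.inl 0) (.inr (.inr 0)) = M (.inl 0) (.inr (.inr 0)) := by
    apply mul_right_cancel₀ h1
    rw [k2] at f01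
    linarith
  rcases i with i | i
  · fin_cases i <;> fin_cases b <;> assumption
  · exact hlow i b

lemma toMat_transpose_symm (g : SO0 s) :
    (toMat g * (toMat g)ᵀ)ᵀ = toMat g * (toMat g)ᵀ := by
  rw [Matrix.transpose_mul, Matrix.transpose_transpose]

lemma toMat_gram_mul_etaT_mul (g : SO0 s) :
    toMat g * (toMat g)ᵀ * etaT s * (toMat g * (toMat g)ᵀ) = etaT s := by
  calc _ = toMat g * ((toMat g)ᵀ * etaT s * toMat g) * (toMat g)ᵀ := by
        simp only [Matrix.mul_assoc]
    _ = etaT s := by rw [toMat_transpose_mul_etaT_mul, toMat_mul_etaT_mul_transpose]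

lemma toMat_gram_posDef (g : SO0 s) : (toMat g * (toMat g)ᵀ).PosDef := by
  have h : IsUnit (toMat g) := by
    rw [Matrix.isUnit_iff_isUnit_det, det_toMat]; exact isUnit_one
  exact Matrix.PosDef.mul_conjTranspose_self _ (Matrix.vecMul_injective_of_isUnit h)

/-- The solvable coordinates can be read off from the entries of `𝕃 𝕃ᵀ` in its last two columns.
The parameters `m`, `b`, `c` are the entries of the lower right block; `m > 0` and the positive
determinant give the Cartan coordinates. -/
lemma exists_explicitL_gram (m c b r : ℝ) (p q : Fin (2 * s) → ℝ) (hm : 0 < m)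
    (hd : 0 < m * c - b ^ 2) : ∃ Y : SolvCoord s,
      let P := explicitL Y * (explicitL Y)ᵀ
      P (.inr (.inr 1)) (.inr (.inr 1)) = m ∧ P (.inr (.inr 0)) (.inr (.inr 0)) = c ∧
      P (.inr (.inr 0)) (.inr (.inr 1)) = b ∧ P (.inl 1) (.inr (.inr 1)) = r ∧
      (∀ k, P (.inr (.inl k)) (.inr (.inr 0)) = p k) ∧
      ∀ k, P (.inr (.inl k)) (.inr (.inr 1)) = q k := by
  obtain ⟨α, hα, hαm⟩ : ∃ α : ℝ, 0 < α ∧ α ^ 2 = m := ⟨√m, Real.sqrt_pos.2 hm, Real.sq_sqrt hm.le⟩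
  have hd' : 0 < (m * c - b ^ 2) / m := div_pos hd hm
  obtain ⟨β, hβ, hβm⟩ : ∃ β : ℝ, 0 < β ∧ β ^ 2 = (m * c - b ^ 2) / m :=
    ⟨_, Real.sqrt_pos.2 hd', Real.sq_sqrt hd'.le⟩
  have hβm' : β ^ 2 * α ^ 2 = α ^ 2 * c - b ^ 2 := by
    rw [hβm, hαm]; field_simp
  let x3 := -(√2 * b / (α * β))
  let x5 : Fin (2 * s) → ℝ := fun k => -(√2 * q k / α)
  let Y : SolvCoord s :=
    { x1 := -Real.log α, x2 := -Real.log β, x3 := x3, x4 := -(√2 * β * r / α), x5 := x5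
      x6 := fun k => -(√2 * (p k - β * x3 * x5 k / 2) / β) }
  have h1 : Real.exp (-Y.x1) = α := by simp [Y, Real.exp_log hα]
  have h2 : Real.exp (-Y.x2) = β := by simp [Y, Real.exp_log hβ]
  have h2' : Real.exp Y.x2 = β⁻¹ := by rw [← inv_inv (Real.exp Y.x2), ← Real.exp_neg, h2]
  have hs : √2 ≠ 0 := by norm_num
  have hs2 : √2 ^ 2 = 2 := by norm_num
  refine ⟨Y, ?_, ?_, ?_, ?_, fun k => ?_, fun k => ?_⟩
  all_goals
    simp [explicitL, Matrix.mul_apply, Fintype.sum_sum_type, h1, h2, h2', Matrix.one_apply]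
  · rw [← hαm, pow_two]
  all_goals simp [Y, x3, x5]
  all_goals field_simp
  all_goals try simp only [hs2]
  · linear_combination hβm'
  · ring

/-- Iwasawa decomposition: the solvable group acts transitively. -/
theorem exists_point_eq (g : SO0 s) : ∃ Y : SolvCoord s, point Y = (g : SymmSpace s) := by
  set M := toMat g * (toMat g)ᵀ with hMdef
  have hMs : Mᵀ = M := toMat_transpose_symm g
  have hM : M * etaT s * M = etaT s := toMat_gram_mul_etaT_mul g
  have hpos : M.PosDef := toMat_gram_posDef g
  have hsym : ∀ i j, M i j = M j i := fun i j => congrFun (congrFun hMs j) i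
  have hm : 0 < M (.inr (.inr 1)) (.inr (.inr 1)) := hpos.diag_pos
  have hd : 0 < M (.inr (.inr 1)) (.inr (.inr 1)) * M (.inr (.inr 0)) (.inr (.inr 0)) -
      M (.inr (.inr 0)) (.inr (.inr 1)) ^ 2 := by
    have h := (hpos.submatrix (e := fun b : Fin 2 => (.inr (.inr b) : IdxT s))
      (fun a b h => by simpa using h)).det_pos
    rw [Matrix.det_fin_two] at h
    simp only [Matrix.submatrix_apply, hsym (.inr (.inr 1)) (.inr (.inr 0))] at h
    linarith
  obtain ⟨Y, h1, h2, h3, h4, h5, h6⟩ := exists_explicitL_gram _ _ _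
    (M (.inl 1) (.inr (.inr 1))) (fun k => M (.inr (.inl k)) (.inr (.inr 0)))
    (fun k => M (.inr (.inl k)) (.inr (.inr 1))) hm hd
  refine ⟨Y, QuotientGroup.eq.2 ?_⟩
  rw [← toMat_cosetRep] at h1 h2 h3 h4 h5 h6
  set l := cosetRep Y with hl
  set P := toMat l * (toMat l)ᵀ with hPdef
  have hPs : Pᵀ = P := toMat_transpose_symm l
  have hcol : ∀ i b, P i (.inr (.inr b)) = M i (.inr (.inr b)) := by
    refine last_columns_eq hMs hPs hM (toMat_gram_mul_etaT_mul l) hm.ne' hd.ne' ?_ h4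
    rintro (k | a) b
    · fin_cases b
      · exact h5 k
      · exact h6 k
    · fin_cases a <;> fin_cases b
      · exact h2
      · exact h3
      · exact (congrFun (congrFun hPs (.inr (.inr 0))) (.inr (.inr 1))).trans
          (h3.trans (hsym _ _))
      · exact h1
  set K := toMat (l⁻¹ * g) * (toMat (l⁻¹ * g))ᵀ with hK
  have hKs : Kᵀ = K := toMat_transpose_symm _
  have hLK : toMat l * K * (toMat l)ᵀ = M := by
    rw [hK, toMat_mul, Matrix.transpose_mul]
    calc _ = (toMat l * toMat l⁻¹) * M * (toMat l * toMat l⁻¹)ᵀ := by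
          rw [hMdef, Matrix.transpose_mul]; simp only [Matrix.mul_assoc]
      _ = M := by rw [toMat_mul_toMat_inv]; simp
  -- `K` fixes the last two rows of the triangular matrix `l`
  have hKl : ∀ i b, (K * (toMat l)ᵀ) i (.inr (.inr b)) = toMat l (.inr (.inr b)) i := by
    intro i b
    have e1 : K * (toMat l)ᵀ = toMat l⁻¹ * M := by
      rw [← hLK, ← Matrix.mul_assoc, ← Matrix.mul_assoc, toMat_inv_mul_toMat, Matrix.one_mul]
    have e2 : (toMat l)ᵀ = toMat l⁻¹ * P := by
      rw [hPdef, ← Matrix.mul_assoc, toMat_inv_mul_toMat, Matrix.one_mul]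
    rw [e1, Matrix.mul_apply, ← Matrix.transpose_apply (toMat l), e2, Matrix.mul_apply]
    simp only [hcol]
  have hKN : ∀ i b, K i (.inr (.inr b)) = (1 : Matrix (IdxT s) (IdxT s) ℝ) i (.inr (.inr b)) := by
    have r1 : ∀ j, toMat l (.inr (.inr 1)) j =
        Real.exp (-Y.x1) * (1 : Matrix (IdxT s) (IdxT s) ℝ) j (.inr (.inr 1)) := by
      intro j
      rw [hl, toMat_cosetRep]
      rcases j with j | j | j <;> try fin_cases j
      all_goals simp [explicitL, Matrix.one_apply]
    have r0 : ∀ j, toMat l (.inr (.inr 0)) j =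
        Real.exp (-Y.x2) * (1 : Matrix (IdxT s) (IdxT s) ℝ) j (.inr (.inr 0)) +
        -(Real.exp (-Y.x2) / √2) * Y.x3 *
          (1 : Matrix (IdxT s) (IdxT s) ℝ) j (.inr (.inr 1)) := by
      intro j
      rw [hl, toMat_cosetRep]
      rcases j with j | j | j <;> try fin_cases j
      all_goals simp [explicitL, Matrix.one_apply]
    have k1 : ∀ i, K i (.inr (.inr 1)) =
        (1 : Matrix (IdxT s) (IdxT s) ℝ) i (.inr (.inr 1)) := by
      intro i
      have h := hKl i 1
      rw [Matrix.mul_apply] at h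
      simp only [Matrix.transpose_apply, r1, mul_left_comm (K _ _), ← Finset.mul_sum] at h
      rw [← Matrix.mul_apply, Matrix.mul_one] at h
      exact mul_left_cancel₀ (Real.exp_pos _).ne' h
    intro i b
    fin_cases b
    · have h := hKl i 0
      rw [Matrix.mul_apply] at h
      simp only [Matrix.transpose_apply, r0, mul_add, mul_left_comm (K _ _), ← Finset.mul_sum,
        Finset.sum_add_distrib] at h
      rw [← Matrix.mul_apply, ← Matrix.mul_apply, Matrix.mul_one, k1] at h
      exact mul_left_cancel₀ (Real.exp_pos _).ne' (add_right_cancel h)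
    · exact k1 i
  have hK1 : ∀ i b, K i (.inl b) = (1 : Matrix (IdxT s) (IdxT s) ℝ) i (.inl b) := by
    intro i b
    have h := congrFun (congrFun (toMat_gram_mul_etaT_mul (l⁻¹ * g)) i) (.inr (.inr b.rev))
    rw [← hK, Matrix.mul_apply] at h
    simp only [hKN] at h
    rw [← Matrix.mul_apply, Matrix.mul_one, mul_etaT_apply_inr, Fin.rev_rev] at h
    rw [h]
    rcases i with i | i | i
    · simp [etaT, Matrix.one_apply, Fin.rev_eq_iff, eq_comm]
    · simp [etaT]
    · simp [etaT]
  apply mem_Hc_of_lower_gram_eq_one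
  have : hatMat (l⁻¹ * g) * (hatMat (l⁻¹ * g))ᵀ = Omega s * K * (Omega s)ᵀ := by
    rw [hatMat, Omega_conj_transpose, Omega_conj_mul]
  rw [this]
  ext a b
  have hΩ : ∀ i b, (Omega s * K) i (.inl b) = Omega s i (.inl b) ∧
      (Omega s * K) i (.inr (.inr b)) = Omega s i (.inr (.inr b)) := by
    intro i b
    rw [Matrix.mul_apply, Matrix.mul_apply]
    simp only [hK1, hKN]
    rw [← Matrix.mul_apply, ← Matrix.mul_apply, Matrix.mul_one]
    exact ⟨rfl, rfl⟩
  change (Omega s * K * (Omega s)ᵀ) (.inr a) (.inr b) = _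
  rw [mul_Omega_transpose_apply, Omega_mul_apply_inr, Matrix.transpose_apply,
    Matrix.transpose_apply, (hΩ _ _).1, (hΩ _ _).2]
  have h := congrFun (congrFun (Omega_mul_transpose s) (.inr a)) (.inr b)
  rw [mul_Omega_transpose_apply, Omega_mul_apply_inr, Matrix.transpose_apply,
    Matrix.transpose_apply] at h
  rw [h]
  simp [Matrix.one_apply]
lemma eq_of_explicitL_gram_eq {U V : SolvCoord s}
    (h : explicitL U * (explicitL U)ᵀ = explicitL V * (explicitL V)ᵀ) : U = V := by
  have hs : √2 ≠ 0 := by norm_num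
  have e := fun i j => congrFun (congrFun h i) j
  have e11 := e (.inr (.inr 1)) (.inr (.inr 1))
  have e00 := e (.inr (.inr 0)) (.inr (.inr 0))
  have e01 := e (.inr (.inr 0)) (.inr (.inr 1))
  have e21 := e (.inl 1) (.inr (.inr 1))
  have ek0 := fun k => e (.inr (.inl k)) (.inr (.inr 0))
  have ek1 := fun k => e (.inr (.inl k)) (.inr (.inr 1))
  simp [explicitL, Matrix.mul_apply, Fintype.sum_sum_type, Matrix.one_apply]
    at e11 e00 e01 e21 ek0 ek1
  have h1 : U.x1 = V.x1 := neg_injective (Real.exp_injective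
    ((mul_self_inj (Real.exp_pos _).le (Real.exp_pos _).le).1 e11))
  simp only [h1, mul_eq_mul_right_iff, (Real.exp_pos _).ne', or_false] at e01 e21 ek1
  have h3' : Real.exp (-U.x2) / √2 * U.x3 = Real.exp (-V.x2) / √2 * V.x3 := by linarith
  rw [h3', add_left_inj] at e00
  have h2 : U.x2 = V.x2 := neg_injective (Real.exp_injective
    ((mul_self_inj (Real.exp_pos _).le (Real.exp_pos _).le).1 e00))
  rw [h2] at h3' e21
  have h3 : U.x3 = V.x3 := mul_left_cancel₀ (div_pos (Real.exp_pos _) (by positivity)).ne' h3'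
  have h4 : U.x4 = V.x4 := by
    refine mul_left_cancel₀ (div_pos (Real.exp_pos V.x2) (by positivity : 0 < √2)).ne' ?_
    linarith
  have h5 : U.x5 = V.x5 := by
    ext k
    have := ek1 k
    simpa [hs] using this
  have h6 : U.x6 = V.x6 := by
    ext k
    have := ek0 k
    rw [h2, h3, h5] at this
    simpa [hs] using this
  exact SolvCoord.ext h1 h2 h3 h4 h5 h6

theorem point_bijective : Function.Bijective (point : SolvCoord s → SymmSpace s) := by
  refine ⟨fun U V h => ?_, fun p => ?_⟩
  · have hmem : (cosetRep U)⁻¹ * cosetRep V ∈ Hc s := QuotientGroup.eq.1 h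
    have hg := toMat_mul_transpose_of_mem_Hc hmem
    have hV : toMat (cosetRep V) = toMat (cosetRep U) * toMat ((cosetRep U)⁻¹ * cosetRep V) := by
      rw [← toMat_mul, mul_inv_cancel_left]
    apply eq_of_explicitL_gram_eq
    rw [← toMat_cosetRep, ← toMat_cosetRep, hV, Matrix.transpose_mul]
    calc toMat (cosetRep U) * (toMat (cosetRep U))ᵀ
        = toMat (cosetRep U) * 1 * (toMat (cosetRep U))ᵀ := by rw [Matrix.mul_one]
      _ = _ := by rw [← hg]; simp only [Matrix.mul_assoc]
  · obtain ⟨g, rfl⟩ := QuotientGroup.mk_surjective p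
    exact exists_point_eq g

/-! ### Curves and lengths -/

/-- Entrywise derivative at `t`, within `[0, 1]`, of a matrix-valued function. -/
def HasMatDeriv {m n : Type*} (A : ℝ → Matrix m n ℝ) (A' : Matrix m n ℝ) (t : ℝ) : Prop :=
  ∀ i j, HasDerivWithinAt (fun τ => A τ i j) (A' i j) (Icc 0 1) t

section HasMatDeriv

variable {l m n : Type*} [Fintype m] {t : ℝ}

lemma HasMatDeriv.mul {A : ℝ → Matrix l m ℝ} {B : ℝ → Matrix m n ℝ} {A' B'}
    (hA : HasMatDeriv A A' t) (hB : HasMatDeriv B B' t) :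
    HasMatDeriv (fun τ => A τ * B τ) (A' * B t + A t * B') t := by
  intro i j
  simp only [Matrix.mul_apply, Matrix.add_apply, ← Finset.sum_add_distrib]
  exact HasDerivWithinAt.fun_sum fun k _ => (hA i k).fun_mul (hB k j)

lemma HasMatDeriv.const (A : Matrix l n ℝ) (t : ℝ) : HasMatDeriv (fun _ => A) 0 t :=
  fun _ _ => hasDerivWithinAt_const ..

lemma HasMatDeriv.transpose {A : ℝ → Matrix l n ℝ} {A'} (hA : HasMatDeriv A A' t) :
    HasMatDeriv (fun τ => (A τ)ᵀ) A'ᵀ t := fun i j => hA j i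

lemma HasMatDeriv.unique {A : ℝ → Matrix l n ℝ} {A' A''} (ht : t ∈ Icc (0 : ℝ) 1)
    (h' : HasMatDeriv A A' t) (h'' : HasMatDeriv A A'' t) : A' = A'' := by
  ext i j
  exact (uniqueDiffOn_Icc zero_lt_one t ht).eq_deriv _ (h' i j) (h'' i j)

end HasMatDeriv

lemma IsC1Curve.hasMatDeriv {γ : ℝ → SO0 s} (hγ : IsC1Curve γ) {t : ℝ}
    (ht : t ∈ Icc (0 : ℝ) 1) : HasMatDeriv (fun τ => toMat (γ τ)) (velocity γ t) t :=
  fun i j => ((hγ i j).differentiableOn one_ne_zero t ht).hasDerivWithinAt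

lemma toMat_mul_leftForm (γ : ℝ → SO0 s) (t : ℝ) :
    toMat (γ t) * leftForm γ t = velocity γ t := by
  rw [leftForm, ← Matrix.mul_assoc, toMat_mul_toMat_inv, Matrix.one_mul]

lemma vielbein_transpose (γ : ℝ → SO0 s) (t : ℝ) : (vielbein γ t)ᵀ = vielbein γ t := by
  rw [vielbein, Matrix.transpose_smul, Matrix.transpose_add, Matrix.transpose_transpose, add_comm]

/-- Length is unchanged by `g ↦ A g B` with `B` orthogonal. -/
lemma IsC1Curve.curveLength_transform {γ δ : ℝ → SO0 s} (hγ : IsC1Curve γ)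
    {A A' B : Matrix (IdxT s) (IdxT s) ℝ} (hA : A' * A = 1) (hB : B * Bᵀ = 1)
    (h : ∀ t, toMat (δ t) = A * toMat (γ t) * B) :
    IsC1Curve δ ∧ curveLength δ = curveLength γ := by
  have hδ : IsC1Curve δ := by
    intro i j
    simp only [h, Matrix.mul_apply]
    exact ContDiffOn.sum fun k _ =>
      (ContDiffOn.sum fun l _ => contDiffOn_const.mul (hγ l k)).mul contDiffOn_const
  refine ⟨hδ, ?_⟩
  have hB' : Bᵀ * B = 1 := mul_eq_one_comm.1 hB
  have hinv : ∀ t, toMat (δ t)⁻¹ = Bᵀ * toMat (γ t)⁻¹ * A' := by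
    intro t
    have e : Bᵀ * toMat (γ t)⁻¹ * A' * toMat (δ t) = 1 := by
      calc _ = Bᵀ * (toMat (γ t)⁻¹ * (A' * A) * toMat (γ t)) * B := by
            rw [h]; simp only [Matrix.mul_assoc]
        _ = 1 := by rw [hA, Matrix.mul_one, toMat_inv_mul_toMat, Matrix.mul_one, hB']
    rw [← Matrix.mul_one (Bᵀ * toMat (γ t)⁻¹ * A'), ← toMat_mul_toMat_inv (δ t),
      ← Matrix.mul_assoc, e, Matrix.one_mul]
  refine intervalIntegral.integral_congr fun t ht => ?_
  rw [uIcc_of_le zero_le_one] at ht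
  have hv : velocity δ t = A * velocity γ t * B := by
    have h1 := (((HasMatDeriv.const A t).mul (hγ.hasMatDeriv ht)).mul (HasMatDeriv.const B t))
    have h2 := hδ.hasMatDeriv ht
    simp only [h] at h2
    rw [h2.unique ht h1]
    simp
  have hl : leftForm δ t = Bᵀ * leftForm γ t * B := by
    rw [leftForm, hinv, hv, leftForm]
    calc _ = Bᵀ * (toMat (γ t)⁻¹ * (A' * A) * velocity γ t) * B := by simp only [Matrix.mul_assoc]
      _ = _ := by rw [hA, Matrix.mul_one]
  have hV : vielbein δ t = Bᵀ * vielbein γ t * B := by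
    rw [vielbein, hl, vielbein]
    simp only [Matrix.transpose_mul, Matrix.transpose_transpose, Matrix.mul_smul,
      Matrix.smul_mul, Matrix.mul_add, Matrix.add_mul, Matrix.mul_assoc]
  have htr : (vielbein δ t * vielbein δ t).trace = (vielbein γ t * vielbein γ t).trace := by
    calc _ = (Bᵀ * (vielbein γ t * (B * Bᵀ) * vielbein γ t * B)).trace := by
          rw [hV]; simp only [Matrix.mul_assoc]
      _ = _ := by
          rw [hB, Matrix.mul_one, Matrix.trace_mul_comm, Matrix.mul_assoc, hB, Matrix.mul_one]
  simp only [htr]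

/-- The lengths of the `C¹` curves joining two points. -/
def lengthSet (p q : SymmSpace s) : Set ℝ :=
  {ℓ : ℝ | ∃ γ : ℝ → SO0 s, IsC1Curve γ ∧ (γ 0 : SymmSpace s) = p ∧
    (γ 1 : SymmSpace s) = q ∧ curveLength γ = ℓ}

lemma lengthSet_subset_of_mul_left (u g h : SO0 s) :
    lengthSet (g : SymmSpace s) h ⊆ lengthSet ((u * g : SO0 s) : SymmSpace s) (u * h : SO0 s) := by
  rintro _ ⟨γ, hγ, h0, h1, rfl⟩
  obtain ⟨hC, hL⟩ := hγ.curveLength_transform (δ := fun t => u * γ t) (A := toMat u)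
    (A' := toMat u⁻¹) (B := 1) (toMat_inv_mul_toMat u) (by simp)
    (fun t => by rw [toMat_mul, Matrix.mul_one])
  refine ⟨_, hC, ?_, ?_, hL⟩
  · rw [QuotientGroup.eq] at h0 ⊢
    simpa [mul_assoc] using h0
  · rw [QuotientGroup.eq] at h1 ⊢
    simpa [mul_assoc] using h1

lemma geodDist_mul_left (u g h : SO0 s) :
    geodDist ((u * g : SO0 s) : SymmSpace s) (u * h : SO0 s) = geodDist (g : SymmSpace s) h := by
  have h1 := lengthSet_subset_of_mul_left u⁻¹ (u * g) (u * h)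
  rw [inv_mul_cancel_left, inv_mul_cancel_left] at h1
  exact congrArg sInf (Subset.antisymm h1 (lengthSet_subset_of_mul_left u g h))

theorem geodDist_point_sq (U V : SolvCoord s) :
    geodDist (point U) (point V) ^ 2 = sqNorm (cosetRep (quotCoord U V)) := by
  rw [sqNorm, ← inv_cosetRep_mul_cosetRep, ← geodDist_mul_left (cosetRep U), mul_one,
    mul_inv_cancel_left]
  rfl

/-! ### The lower bound for the length -/

lemma etaT_mul_vielbein {γ : ℝ → SO0 s} (hγ : IsC1Curve γ) {t : ℝ} (ht : t ∈ Icc (0 : ℝ) 1) :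
    etaT s * vielbein γ t = -(vielbein γ t * etaT s) := by
  have hd := hγ.hasMatDeriv ht
  have h1 := (hd.transpose.mul (HasMatDeriv.const (etaT s) t)).mul hd
  simp only [toMat_transpose_mul_etaT_mul] at h1
  have h2 := h1.unique ht (HasMatDeriv.const (etaT s) t)
  set Θ := leftForm γ t with hΘ
  have h3 : Θᵀ * etaT s + etaT s * Θ = 0 := by
    rw [← toMat_mul_leftForm, ← hΘ, Matrix.mul_zero, add_zero, Matrix.transpose_mul] at h2
    rw [← h2, ← Matrix.mul_assoc, toMat_transpose_mul_etaT_mul, Matrix.mul_assoc,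
      Matrix.mul_assoc, ← Matrix.mul_assoc _ (etaT s), toMat_transpose_mul_etaT_mul]
  have h4 : etaT s * Θ = -(Θᵀ * etaT s) := eq_neg_of_add_eq_zero_right h3
  have h5 : etaT s * Θᵀ = -(Θ * etaT s) := by
    calc etaT s * Θᵀ = etaT s * (Θᵀ * etaT s) * etaT s := by
          rw [Matrix.mul_assoc, Matrix.mul_assoc, etaT_mul_self, Matrix.mul_one]
      _ = -(etaT s * etaT s * Θ * etaT s) := by
          rw [← neg_eq_iff_eq_neg.2 h4, Matrix.mul_neg, Matrix.neg_mul]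
          simp only [Matrix.mul_assoc]
      _ = _ := by rw [etaT_mul_self, Matrix.one_mul]
  rw [vielbein, ← hΘ, Matrix.mul_smul, Matrix.smul_mul, Matrix.mul_add, Matrix.add_mul, h4, h5,
    ← smul_neg]
  congr 1
  abel

/-- A symmetric matrix anticommuting with `η` has opposite diagonal entries at the paired
positions, so the square of each of them occurs twice in the trace of `V²`. -/
lemma two_mul_diag_sq_le_trace {V : Matrix (IdxT s) (IdxT s) ℝ} (hs : Vᵀ = V)
    (hV : etaT s * V = -(V * etaT s)) :
    2 * (V (.inr (.inr 1)) (.inr (.inr 1)) ^ 2 + V (.inr (.inr 0)) (.inr (.inr 0)) ^ 2) ≤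
      (V * V).trace := by
  have hsym : ∀ i j, V i j = V j i := fun i j => congrFun (congrFun hs j) i
  have hanti : ∀ b : Fin 2, V (.inl b.rev) (.inl b.rev) = -V (.inr (.inr b)) (.inr (.inr b)) := by
    intro b
    have h := congrFun (congrFun hV (.inl b.rev)) (.inr (.inr b))
    have h1 : etaT s * V = (V * etaT s)ᵀ := by rw [Matrix.transpose_mul, etaT_transpose, hs]
    rw [h1, Matrix.transpose_apply, Matrix.neg_apply, mul_etaT_apply_inl, mul_etaT_apply_inr,
      Fin.rev_rev] at h
    rw [h, neg_neg]
  have hdiag : ∑ i, V i i ^ 2 ≤ (V * V).trace := by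
    refine Finset.sum_le_sum fun i _ => ?_
    rw [Matrix.diag_apply, Matrix.mul_apply, pow_two]
    refine Finset.single_le_sum (f := fun j => V i j * V j i) (fun j _ => ?_) (Finset.mem_univ i)
    rw [hsym j i]
    exact mul_self_nonneg _
  refine le_trans ?_ hdiag
  have a0 : V (.inl 1) (.inl 1) = -V (.inr (.inr 0)) (.inr (.inr 0)) := hanti 0
  have a1 : V (.inl 0) (.inl 0) = -V (.inr (.inr 1)) (.inr (.inr 1)) := hanti 1
  rw [Fintype.sum_sum_type, Fintype.sum_sum_type, Fin.sum_univ_two, Fin.sum_univ_two, a0, a1]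
  have : 0 ≤ ∑ k, V (.inr (.inl k)) (.inr (.inl k)) ^ 2 := Finset.sum_nonneg fun _ _ => sq_nonneg _
  linarith

lemma etaT_mul_of_mem_Hc {k : SO0 s} (hk : k ∈ Hc s) :
    toMat k * etaT s = etaT s * toMat k := by
  have h := toMat_mul_transpose_of_mem_Hc hk
  have h' : (toMat k)ᵀ * toMat k = 1 := mul_eq_one_comm.1 h
  rw [← Matrix.mul_one (toMat k * etaT s), ← h', ← Matrix.mul_assoc, toMat_mul_etaT_mul_transpose]

/-- At a point of a curve with Iwasawa decomposition `γ = 𝕃(Y) k`, the derivative of `γ γᵀ` is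
`2 𝕃 V 𝕃ᵀ`, where `V = k 𝕍 kᵀ` is the conjugated vielbein. Its last two diagonal entries bound the
speed of the curve from below. -/
lemma exists_conj_vielbein {γ : ℝ → SO0 s} (hγ : IsC1Curve γ) {t : ℝ} (ht : t ∈ Icc (0 : ℝ) 1)
    {Y : SolvCoord s} (hY : point Y = (γ t : SymmSpace s)) :
    ∃ V : Matrix (IdxT s) (IdxT s) ℝ,
      2 * (V (.inr (.inr 1)) (.inr (.inr 1)) ^ 2 + V (.inr (.inr 0)) (.inr (.inr 0)) ^ 2) ≤
        (vielbein γ t * vielbein γ t).trace ∧ Vᵀ = V ∧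
      HasMatDeriv (fun τ => toMat (γ τ) * (toMat (γ τ))ᵀ)
        ((2 : ℝ) • (explicitL Y * V * (explicitL Y)ᵀ)) t := by
  set l := cosetRep Y with hl
  have hk : l⁻¹ * γ t ∈ Hc s := QuotientGroup.eq.1 hY
  set k := l⁻¹ * γ t with hkdef
  have hkk := toMat_mul_transpose_of_mem_Hc hk
  have hkk' : (toMat k)ᵀ * toMat k = 1 := mul_eq_one_comm.1 hkk
  have hγk : toMat (γ t) = toMat l * toMat k := by rw [← toMat_mul, hkdef, mul_inv_cancel_left]
  have hkη := etaT_mul_of_mem_Hc hk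
  have hkη' : etaT s * (toMat k)ᵀ = (toMat k)ᵀ * etaT s := by
    have := congrArg Matrix.transpose hkη
    rwa [Matrix.transpose_mul, Matrix.transpose_mul, etaT_transpose] at this
  refine ⟨toMat k * vielbein γ t * (toMat k)ᵀ, ?_, ?_, ?_⟩
  · have htr : (toMat k * vielbein γ t * (toMat k)ᵀ * (toMat k * vielbein γ t * (toMat k)ᵀ)).trace =
        (vielbein γ t * vielbein γ t).trace := by
      calc _ = (toMat k * (vielbein γ t * ((toMat k)ᵀ * toMat k) * vielbein γ t *
            (toMat k)ᵀ)).trace := by simp only [Matrix.mul_assoc]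
        _ = _ := by
            rw [hkk', Matrix.mul_one, Matrix.trace_mul_comm, Matrix.mul_assoc, hkk',
              Matrix.mul_one]
    rw [← htr]
    apply two_mul_diag_sq_le_trace
    · simp only [Matrix.transpose_mul, Matrix.transpose_transpose, vielbein_transpose,
        Matrix.mul_assoc]
    · calc _ = toMat k * (etaT s * vielbein γ t) * (toMat k)ᵀ := by
            rw [← Matrix.mul_assoc, ← Matrix.mul_assoc, ← hkη, Matrix.mul_assoc _ (etaT s)]
        _ = _ := by
            rw [etaT_mul_vielbein hγ ht, Matrix.mul_assoc _ _ (etaT s), ← hkη']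
            simp only [Matrix.mul_neg, Matrix.neg_mul, Matrix.mul_assoc]
  · simp only [Matrix.transpose_mul, Matrix.transpose_transpose, vielbein_transpose,
      Matrix.mul_assoc]
  · have hd := hγ.hasMatDeriv ht
    have h1 := hd.mul hd.transpose
    convert h1 using 1
    rw [← toMat_mul_leftForm, Matrix.transpose_mul]
    calc (2 : ℝ) • (explicitL Y * (toMat k * vielbein γ t * (toMat k)ᵀ) * (explicitL Y)ᵀ)
        = toMat (γ t) * ((2 : ℝ) • vielbein γ t) * (toMat (γ t))ᵀ := by
          rw [hγk, ← toMat_cosetRep, Matrix.transpose_mul, Matrix.mul_smul, Matrix.smul_mul]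
          simp only [Matrix.mul_assoc, ← hl]
      _ = _ := by
          rw [vielbein, smul_smul]
          norm_num [Matrix.mul_add, Matrix.add_mul, Matrix.mul_assoc]

/-- The lower right block of `𝕃 V 𝕃ᵀ` only involves that of `V`, since `𝕃` is upper triangular. -/
lemma explicitL_conj_apply_last (Y : SolvCoord s) (V : Matrix (IdxT s) (IdxT s) ℝ) :
    let δ := -(Real.exp (-Y.x2) / √2) * Y.x3
    (explicitL Y * V * (explicitL Y)ᵀ) (.inr (.inr 1)) (.inr (.inr 1)) =
      Real.exp (-Y.x1) ^ 2 * V (.inr (.inr 1)) (.inr (.inr 1)) ∧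
    (explicitL Y * V * (explicitL Y)ᵀ) (.inr (.inr 0)) (.inr (.inr 1)) =
      Real.exp (-Y.x1) * (Real.exp (-Y.x2) * V (.inr (.inr 0)) (.inr (.inr 1)) +
        δ * V (.inr (.inr 1)) (.inr (.inr 1))) ∧
    (explicitL Y * V * (explicitL Y)ᵀ) (.inr (.inr 0)) (.inr (.inr 0)) =
      Real.exp (-Y.x2) ^ 2 * V (.inr (.inr 0)) (.inr (.inr 0)) +
        Real.exp (-Y.x2) * δ * (V (.inr (.inr 0)) (.inr (.inr 1)) +
          V (.inr (.inr 1)) (.inr (.inr 0))) + δ ^ 2 * V (.inr (.inr 1)) (.inr (.inr 1)) := by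
  refine ⟨?_, ?_, ?_⟩ <;>
    simp [explicitL, Matrix.mul_apply, Fintype.sum_sum_type] <;> ring

lemma toMat_gram_eq_explicitL {g : SO0 s} {Y : SolvCoord s} (hY : point Y = (g : SymmSpace s)) :
    toMat g * (toMat g)ᵀ = explicitL Y * 1 * (explicitL Y)ᵀ := by
  have hk := toMat_mul_transpose_of_mem_Hc (QuotientGroup.eq.1 hY)
  rw [← toMat_cosetRep, ← hk]
  calc toMat g * (toMat g)ᵀ
      = toMat (cosetRep Y * ((cosetRep Y)⁻¹ * g)) *
          (toMat (cosetRep Y * ((cosetRep Y)⁻¹ * g)))ᵀ := by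
        rw [mul_inv_cancel_left]
    _ = _ := by rw [toMat_mul, Matrix.transpose_mul]; simp only [Matrix.mul_assoc]

/-- The Cartan coordinates of a curve are differentiable, and any unit linear combination of them
changes at most at `1 / √2` times the speed of the curve. -/
lemma exists_hasDerivWithinAt_cartan {γ : ℝ → SO0 s} (hγ : IsC1Curve γ) {Y : ℝ → SolvCoord s}
    (hY : ∀ t, point (Y t) = (γ t : SymmSpace s)) {c₁ c₂ : ℝ} (hc : c₁ ^ 2 + c₂ ^ 2 = 1)
    {t : ℝ} (ht : t ∈ Icc (0 : ℝ) 1) :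
    ∃ d, HasDerivWithinAt (fun τ => c₁ * (Y τ).x1 + c₂ * (Y τ).x2) d (Icc 0 1) t ∧
      √2 * d ≤ √((vielbein γ t * vielbein γ t).trace) := by
  obtain ⟨V, hV, hVs, hM⟩ := exists_conj_vielbein hγ ht (hY t)
  have hsym : V (.inr (.inr 1)) (.inr (.inr 0)) = V (.inr (.inr 0)) (.inr (.inr 1)) :=
    congrFun (congrFun hVs (.inr (.inr 0))) (.inr (.inr 1))
  set m : ℝ → ℝ := fun τ => (toMat (γ τ) * (toMat (γ τ))ᵀ) (.inr (.inr 1)) (.inr (.inr 1)) with hm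
  set b : ℝ → ℝ := fun τ => (toMat (γ τ) * (toMat (γ τ))ᵀ) (.inr (.inr 0)) (.inr (.inr 1)) with hb
  set c : ℝ → ℝ := fun τ => (toMat (γ τ) * (toMat (γ τ))ᵀ) (.inr (.inr 0)) (.inr (.inr 0)) with hcc
  have dm : HasDerivWithinAt m _ (Icc 0 1) t := hM (.inr (.inr 1)) (.inr (.inr 1))
  have db : HasDerivWithinAt b _ (Icc 0 1) t := hM (.inr (.inr 0)) (.inr (.inr 1))
  have dc : HasDerivWithinAt c _ (Icc 0 1) t := hM (.inr (.inr 0)) (.inr (.inr 0))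
  simp only [Matrix.smul_apply, smul_eq_mul] at dm db dc
  obtain ⟨h1, h2, h3⟩ := explicitL_conj_apply_last (Y t) V
  rw [h1] at dm
  rw [h2] at db
  rw [h3] at dc
  have hmv : ∀ τ, m τ = Real.exp (-(Y τ).x1) ^ 2 := fun τ => by
    simp only [hm, toMat_gram_eq_explicitL (hY τ)]
    rw [(explicitL_conj_apply_last (Y τ) 1).1]; simp
  have hbv : ∀ τ, b τ = Real.exp (-(Y τ).x1) *
      (-(Real.exp (-(Y τ).x2) / √2) * (Y τ).x3) := fun τ => by
    simp only [hb, toMat_gram_eq_explicitL (hY τ)]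
    rw [(explicitL_conj_apply_last (Y τ) 1).2.1]; simp
  have hcv : ∀ τ, c τ = Real.exp (-(Y τ).x2) ^ 2 +
      (-(Real.exp (-(Y τ).x2) / √2) * (Y τ).x3) ^ 2 := fun τ => by
    simp only [hcc, toMat_gram_eq_explicitL (hY τ)]
    rw [(explicitL_conj_apply_last (Y τ) 1).2.2]; simp
  have hdv : ∀ τ, m τ * c τ - b τ ^ 2 = (Real.exp (-(Y τ).x1) * Real.exp (-(Y τ).x2)) ^ 2 :=
    fun τ => by rw [hmv, hbv, hcv]; ring
  have hm0 : ∀ τ, 0 < m τ := fun τ => by rw [hmv]; positivity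
  have hd0 : ∀ τ, 0 < m τ * c τ - b τ ^ 2 := fun τ => by rw [hdv]; positivity
  have dlm := dm.log (hm0 t).ne'
  have dld := ((dm.fun_mul dc).fun_sub (db.fun_pow 2)).log (hd0 t).ne'
  have hw1 : ∀ τ, (Y τ).x1 = -(1 / 2) * Real.log (m τ) := fun τ => by
    rw [hmv, Real.log_pow, Real.log_exp]; push_cast; ring
  have hw2 : ∀ τ, (Y τ).x2 = -(1 / 2) * Real.log (m τ * c τ - b τ ^ 2)
      + 1 / 2 * Real.log (m τ) := fun τ => by
    rw [hdv, hmv, Real.log_pow, Real.log_pow, Real.log_mul (Real.exp_pos _).ne'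
      (Real.exp_pos _).ne', Real.log_exp, Real.log_exp]
    push_cast; ring
  refine ⟨-(c₁ * V (.inr (.inr 1)) (.inr (.inr 1)) + c₂ * V (.inr (.inr 0)) (.inr (.inr 0))),
    ?_, ?_⟩
  · simp only [hw1, hw2]
    have hD := ((dlm.const_mul (-(1 / 2))).const_mul c₁).fun_add
      (((dld.const_mul (-(1 / 2))).fun_add (dlm.const_mul (1 / 2))).const_mul c₂)
    refine hD.congr_deriv ?_
    symm
    rw [hdv, hmv, hbv, hcv, hsym]
    have e1 := (Real.exp_pos (-(Y t).x1)).ne'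
    have e2 := (Real.exp_pos (-(Y t).x2)).ne'
    have e3 : √2 ≠ 0 := by norm_num
    push_cast
    field_simp
    ring
  · refine Real.le_sqrt_of_sq_le (le_trans ?_ hV)
    rw [mul_pow, Real.sq_sqrt zero_le_two]
    generalize V (.inr (.inr 1)) (.inr (.inr 1)) = p
    generalize V (.inr (.inr 0)) (.inr (.inr 0)) = q
    have : (c₁ * p + c₂ * q) ^ 2 + (c₁ * q - c₂ * p) ^ 2 = p ^ 2 + q ^ 2 := by
      linear_combination (p ^ 2 + q ^ 2) * hc
    nlinarith [sq_nonneg (c₁ * q - c₂ * p)]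

lemma continuousOn_speed {γ : ℝ → SO0 s} (hγ : IsC1Curve γ) :
    ContinuousOn (fun t => √((vielbein γ t * vielbein γ t).trace)) (Icc 0 1) := by
  have hv : ∀ i j, ContinuousOn (fun t => velocity γ t i j) (Icc 0 1) := fun i j =>
    (hγ i j).continuousOn_derivWithin (uniqueDiffOn_Icc zero_lt_one) le_rfl
  have hi : ∀ i j, ContinuousOn (fun t => toMat (γ t)⁻¹ i j) (Icc 0 1) := fun i j => by
    simp only [toMat_inv, Matrix.mul_apply, Matrix.transpose_apply]
    exact continuousOn_finsetSum _ fun k _ => (continuousOn_finsetSum _ fun l _ =>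
      continuousOn_const.mul (hγ k l).continuousOn).mul continuousOn_const
  have hl : ∀ i j, ContinuousOn (fun t => leftForm γ t i j) (Icc 0 1) := fun i j => by
    simp only [leftForm, Matrix.mul_apply]
    exact continuousOn_finsetSum _ fun k _ => (hi i k).mul (hv k j)
  have hV : ∀ i j, ContinuousOn (fun t => vielbein γ t i j) (Icc 0 1) := fun i j =>
    ((hl i j).add (hl j i)).const_smul (1 / 2 : ℝ)
  refine ContinuousOn.sqrt ?_
  simp only [Matrix.trace, Matrix.diag_apply, Matrix.mul_apply]
  exact continuousOn_finsetSum _ fun i _ =>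
    continuousOn_finsetSum _ fun j _ => (hV i j).mul (hV j i)

/-- A curve is at least as long as the change of its Cartan coordinates. -/
lemma cartan_le_curveLength {γ : ℝ → SO0 s} (hγ : IsC1Curve γ) {U V : SolvCoord s}
    (h0 : (γ 0 : SymmSpace s) = point U) (h1 : (γ 1 : SymmSpace s) = point V) {c₁ c₂ : ℝ}
    (hc : c₁ ^ 2 + c₂ ^ 2 = 1) :
    √2 * (c₁ * (V.x1 - U.x1) + c₂ * (V.x2 - U.x2)) ≤ curveLength γ := by
  choose Y hY using fun t => exists_point_eq (γ t)
  have hY0 : Y 0 = U := point_bijective.1 ((hY 0).trans h0)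
  have hY1 : Y 1 = V := point_bijective.1 ((hY 1).trans h1)
  have key := fun t (ht : t ∈ Icc (0 : ℝ) 1) => exists_hasDerivWithinAt_cartan hγ hY hc ht
  choose! d hd hle using key
  have h := intervalIntegral.sub_le_integral_of_hasDeriv_right_of_le (a := 0) (b := 1)
    (g := fun τ => √2 * (c₁ * (Y τ).x1 + c₂ * (Y τ).x2)) (g' := fun τ => √2 * d τ)
    (φ := fun t => √((vielbein γ t * vielbein γ t).trace)) zero_le_one
    (fun t ht => ((hd t ht).const_mul _).continuousWithinAt)
    (fun t ht => (((hd t (Ioo_subset_Icc_self ht)).const_mul _).hasDerivAt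
      (Icc_mem_nhds ht.1 ht.2)).hasDerivWithinAt)
    (continuousOn_speed hγ).integrableOn_Icc
    (fun t ht => hle t (Ioo_subset_Icc_self ht))
  rw [hY0, hY1] at h
  rw [curveLength]
  linarith

/-! ### Geodesics in the maximal flat -/

/-- The solvable coordinates of a point of the maximal flat. -/
def flatCoord (s : ℕ) (a b : ℝ) : SolvCoord s := ⟨a, b, 0, 0, 0, 0⟩

/-- The exponents of the diagonal matrix of a point of the maximal flat. -/
def flatVec (s : ℕ) (a b : ℝ) : IdxT s → ℝ := Sum.elim ![a, b] (Sum.elim (fun _ => 0) ![-b, -a])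

lemma explicitL_flatCoord (a b : ℝ) :
    explicitL (flatCoord s a b) = Matrix.diagonal fun i => Real.exp (flatVec s a b i) := by
  ext (i | i | i) (j | j | j) <;> try fin_cases i
  all_goals try fin_cases j
  all_goals simp [explicitL, flatCoord, flatVec, Matrix.diagonal_apply, Matrix.one_apply]

lemma flatVec_mul (a b t : ℝ) (i : IdxT s) : flatVec s (t * a) (t * b) i = t * flatVec s a b i := by
  rcases i with i | i | i <;> try fin_cases i
  all_goals simp [flatVec]

/-- The one-parameter group from the origin to a point of the maximal flat has the length of the
corresponding vector. -/
lemma exists_flat_curve (a b : ℝ) : ∃ γ : ℝ → SO0 s, IsC1Curve γ ∧ γ 0 = 1 ∧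
    γ 1 = cosetRep (flatCoord s a b) ∧ curveLength γ = √(2 * (a ^ 2 + b ^ 2)) := by
  have hγ : ∀ t, toMat (cosetRep (flatCoord s (t * a) (t * b))) =
      Matrix.diagonal fun i => Real.exp (t * flatVec s a b i) := fun t => by
    rw [toMat_cosetRep, explicitL_flatCoord]; simp only [flatVec_mul]
  have hC : IsC1Curve fun t => cosetRep (flatCoord s (t * a) (t * b)) := by
    intro i j
    simp only [hγ, Matrix.diagonal_apply]
    split_ifs
    · fun_prop
    · exact contDiffOn_const
  refine ⟨fun t => cosetRep (flatCoord s (t * a) (t * b)), hC, ?_, ?_, ?_⟩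
  · apply toMat_injective
    rw [hγ, toMat_one]
    simp
  · simp
  · have hl : ∀ t ∈ Icc (0 : ℝ) 1, leftForm (fun t => cosetRep (flatCoord s (t * a) (t * b))) t =
        Matrix.diagonal (flatVec s a b) := by
      intro t ht
      have hd : HasMatDeriv (fun t => toMat (cosetRep (flatCoord s (t * a) (t * b))))
          (toMat (cosetRep (flatCoord s (t * a) (t * b))) * Matrix.diagonal (flatVec s a b)) t := by
        intro i j
        simp only [hγ, Matrix.mul_diagonal, Matrix.diagonal_apply]
        split_ifs with hij
        · subst hij
          have := (((hasDerivAt_id t).mul_const (flatVec s a b i)).exp).hasDerivWithinAt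
            (s := Icc 0 1)
          simpa using this
        · simpa using hasDerivWithinAt_const t (Icc 0 1) (0 : ℝ)
      rw [leftForm, (hC.hasMatDeriv ht).unique ht hd, ← Matrix.mul_assoc, toMat_inv_mul_toMat,
        Matrix.one_mul]
    have hs : ∀ t ∈ Icc (0 : ℝ) 1, √((vielbein (fun t => cosetRep (flatCoord s (t * a) (t * b))) t *
        vielbein (fun t => cosetRep (flatCoord s (t * a) (t * b))) t).trace) =
        √(2 * (a ^ 2 + b ^ 2)) := by
      intro t ht
      rw [vielbein, hl t ht, Matrix.diagonal_transpose, ← two_smul ℝ, smul_smul]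
      congr 1
      norm_num [Matrix.trace_diagonal, Fintype.sum_sum_type, flatVec]
      ring
    rw [curveLength, intervalIntegral.integral_congr (g := fun _ => √(2 * (a ^ 2 + b ^ 2)))]
    · simp
    · intro t ht
      rw [uIcc_of_le zero_le_one] at ht
      exact hs t ht

theorem geodDist_flat (a b : ℝ) : geodDist ((1 : SO0 s) : SymmSpace s)
    (cosetRep (flatCoord s a b) : SymmSpace s) = √(2 * (a ^ 2 + b ^ 2)) := by
  obtain ⟨γ, hγ, h0, h1, hL⟩ := exists_flat_curve (s := s) a b
  have h10 : (1 : SO0 s) = cosetRep (flatCoord s 0 0) := by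
    apply toMat_injective
    rw [toMat_one, toMat_cosetRep, explicitL_flatCoord]
    ext i j
    have := flatVec_mul (s := s) 0 0 0 i
    simp only [mul_zero, zero_mul] at this
    simp [Matrix.diagonal_apply, Matrix.one_apply, this]
  refine IsLeast.csInf_eq ⟨⟨γ, hγ, by rw [h0], by rw [h1], hL⟩, ?_⟩
  rintro _ ⟨δ, hδ, hδ0, hδ1, rfl⟩
  rcases eq_or_ne (a ^ 2 + b ^ 2) 0 with hz | hz
  · rw [hz, mul_zero, Real.sqrt_zero]
    exact intervalIntegral.integral_nonneg zero_le_one fun _ _ => Real.sqrt_nonneg _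
  have hpos : 0 < a ^ 2 + b ^ 2 := lt_of_le_of_ne (by positivity) hz.symm
  set r := √(a ^ 2 + b ^ 2) with hr
  have hr2 : r ^ 2 = a ^ 2 + b ^ 2 := Real.sq_sqrt hpos.le
  have hr0 : 0 < r := Real.sqrt_pos.2 hpos
  have h := cartan_le_curveLength hδ (U := flatCoord s 0 0) (V := flatCoord s a b)
    (by rw [hδ0, h10]; rfl) (by rw [hδ1]; rfl) (c₁ := a / r) (c₂ := b / r)
    (by rw [div_pow, div_pow, ← add_div, hr2, div_self hz])
  refine le_trans (le_of_eq ?_) h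
  rw [Real.sqrt_mul zero_le_two, ← hr]
  congr 1
  simp only [flatCoord, sub_zero]
  field_simp
  linarith

/-! ### Conjugation by block-diagonal orthogonal matrices -/

/-- The block-diagonal orthogonal matrix `diag(K₁, K₂)`, written in the triangular basis. -/
def blockRot (K₁ : Matrix (Fin (2 * s) ⊕ Fin 2) (Fin (2 * s) ⊕ Fin 2) ℝ)
    (K₂ : Matrix (Fin 2) (Fin 2) ℝ) : Matrix (IdxT s) (IdxT s) ℝ :=
  (Omega s)ᵀ * Matrix.fromBlocks K₁ 0 0 K₂ * Omega s

section Conj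

variable {K₁ : Matrix (Fin (2 * s) ⊕ Fin 2) (Fin (2 * s) ⊕ Fin 2) ℝ}
  {K₂ : Matrix (Fin 2) (Fin 2) ℝ}

lemma Omega_transpose_conj_mul (A B : Matrix (IdxB s) (IdxB s) ℝ) :
    (Omega s)ᵀ * A * Omega s * ((Omega s)ᵀ * B * Omega s) = (Omega s)ᵀ * (A * B) * Omega s := by
  calc _ = (Omega s)ᵀ * A * (Omega s * (Omega s)ᵀ) * B * Omega s := by simp only [Matrix.mul_assoc]
    _ = _ := by rw [Omega_mul_transpose, Matrix.mul_one]; simp only [Matrix.mul_assoc]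

lemma blockRot_transpose : (blockRot K₁ K₂)ᵀ = blockRot K₁ᵀ K₂ᵀ := by
  simp only [blockRot, Matrix.transpose_mul, Matrix.transpose_transpose,
    Matrix.fromBlocks_transpose, Matrix.transpose_zero, Matrix.mul_assoc]

lemma blockRot_mul_transpose (h₁ : K₁ * K₁ᵀ = 1) (h₂ : K₂ * K₂ᵀ = 1) :
    blockRot K₁ K₂ * (blockRot K₁ K₂)ᵀ = 1 := by
  rw [blockRot_transpose, blockRot, blockRot, Omega_transpose_conj_mul,
    Matrix.fromBlocks_multiply, h₁, h₂]
  simp [Omega_transpose_mul]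

lemma blockRot_mul_etaT_mul_transpose (h₁ : K₁ * K₁ᵀ = 1) (h₂ : K₂ * K₂ᵀ = 1) :
    blockRot K₁ K₂ * etaT s * (blockRot K₁ K₂)ᵀ = etaT s := by
  have h : etaT s = (Omega s)ᵀ * etaB s * Omega s := by
    rw [Matrix.mul_assoc, ← Omega_mul_etaT, ← Matrix.mul_assoc, Omega_transpose_mul,
      Matrix.one_mul]
  rw [blockRot_transpose, h, blockRot, blockRot, Omega_transpose_conj_mul,
    Omega_transpose_conj_mul, etaB, Matrix.fromBlocks_multiply, Matrix.fromBlocks_multiply]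
  simp [h₁, h₂]

/-- Conjugation by `diag(K₁, K₂)` on `SO(η)`. -/
def conjPseudo (h₁ : K₁ * K₁ᵀ = 1) (h₂ : K₂ * K₂ᵀ = 1) (g : pseudoSO s) : pseudoSO s :=
  ⟨⟨blockRot K₁ K₂ * g.1.1 * (blockRot K₁ K₂)ᵀ, by
    rw [Matrix.det_conj_of_mul_eq_one (blockRot_mul_transpose h₁ h₂)
      (mul_eq_one_comm.1 (blockRot_mul_transpose h₁ h₂))]
    exact g.1.2⟩, by
    have hη := blockRot_mul_etaT_mul_transpose (s := s) h₁ h₂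
    have h1 := mul_eq_one_comm.1 (blockRot_mul_transpose (s := s) h₁ h₂)
    have h3 : (blockRot K₁ K₂)ᵀ * etaT s * blockRot K₁ K₂ = etaT s := by
      calc _ = (blockRot K₁ K₂)ᵀ * (blockRot K₁ K₂ * etaT s * (blockRot K₁ K₂)ᵀ) *
            blockRot K₁ K₂ := by rw [hη]
        _ = (blockRot K₁ K₂)ᵀ * blockRot K₁ K₂ * etaT s *
            ((blockRot K₁ K₂)ᵀ * blockRot K₁ K₂) := by simp only [Matrix.mul_assoc]
        _ = _ := by rw [h1, Matrix.one_mul, Matrix.mul_one]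
    change (blockRot K₁ K₂ * g.1.1 * (blockRot K₁ K₂)ᵀ)ᵀ * etaT s *
      (blockRot K₁ K₂ * g.1.1 * (blockRot K₁ K₂)ᵀ) = etaT s
    calc _ = blockRot K₁ K₂ * (g.1.1ᵀ * ((blockRot K₁ K₂)ᵀ * etaT s * blockRot K₁ K₂) * g.1.1) *
          (blockRot K₁ K₂)ᵀ := by
          simp only [Matrix.transpose_mul, Matrix.transpose_transpose, Matrix.mul_assoc]
      _ = etaT s := by rw [h3, show g.1.1ᵀ * etaT s * g.1.1 = etaT s from g.2, hη]⟩

/-- Conjugation by `diag(K₁, K₂)` on the identity component. The blocks need not have determinant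
one. -/
def conjSO (h₁ : K₁ * K₁ᵀ = 1) (h₂ : K₂ * K₂ᵀ = 1) (g : SO0 s) : SO0 s :=
  ⟨conjPseudo h₁ h₂ g.1, by
    have hc : Continuous (conjPseudo (s := s) h₁ h₂) := by
      have hv : Continuous fun x : pseudoSO s => x.1.1 :=
        Continuous.comp (g := fun x : Matrix.SpecialLinearGroup (IdxT s) ℝ => x.1)
          (f := fun x : pseudoSO s => x.1) continuous_subtype_val continuous_subtype_val
      exact Continuous.subtype_mk (Continuous.subtype_mk
        ((continuous_const.matrix_mul hv).matrix_mul continuous_const) _) _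
    have h1 : conjPseudo (s := s) h₁ h₂ 1 = 1 := by
      apply Subtype.ext; apply Subtype.ext
      change blockRot K₁ K₂ * 1 * (blockRot K₁ K₂)ᵀ = 1
      rw [Matrix.mul_one, blockRot_mul_transpose h₁ h₂]
    have h := hc.image_connectedComponent_subset 1 ⟨g.1, g.2, rfl⟩
    rwa [h1] at h⟩

variable (h₁ : K₁ * K₁ᵀ = 1) (h₂ : K₂ * K₂ᵀ = 1)

lemma toMat_conjSO (g : SO0 s) :
    toMat (conjSO h₁ h₂ g) = blockRot K₁ K₂ * toMat g * (blockRot K₁ K₂)ᵀ := rfl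

lemma conjSO_mul (g h : SO0 s) : conjSO h₁ h₂ (g * h) = conjSO h₁ h₂ g * conjSO h₁ h₂ h := by
  apply toMat_injective
  rw [toMat_mul, toMat_conjSO, toMat_conjSO, toMat_conjSO, toMat_mul]
  calc _ = blockRot K₁ K₂ * toMat g * 1 * toMat h * (blockRot K₁ K₂)ᵀ := by
        rw [Matrix.mul_one]; simp only [Matrix.mul_assoc]
    _ = _ := by
        rw [← mul_eq_one_comm.1 (blockRot_mul_transpose (s := s) h₁ h₂)]
        simp only [Matrix.mul_assoc]

lemma conjSO_one : conjSO (s := s) h₁ h₂ 1 = 1 := by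
  apply toMat_injective
  rw [toMat_conjSO, toMat_one, Matrix.mul_one, blockRot_mul_transpose h₁ h₂]

lemma conjSO_inv (g : SO0 s) : conjSO h₁ h₂ g⁻¹ = (conjSO h₁ h₂ g)⁻¹ :=
  eq_inv_of_mul_eq_one_left (by rw [← conjSO_mul, inv_mul_cancel, conjSO_one])

lemma hatMat_conjSO (g : SO0 s) : hatMat (conjSO h₁ h₂ g) =
    Matrix.fromBlocks K₁ 0 0 K₂ * hatMat g * (Matrix.fromBlocks K₁ 0 0 K₂)ᵀ := by
  rw [hatMat, toMat_conjSO, blockRot_transpose, blockRot, blockRot, hatMat]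
  calc _ = (Omega s * (Omega s)ᵀ) * Matrix.fromBlocks K₁ 0 0 K₂ *
        (Omega s * toMat g * (Omega s)ᵀ) * Matrix.fromBlocks K₁ᵀ 0 0 K₂ᵀ *
        (Omega s * (Omega s)ᵀ) := by simp only [Matrix.mul_assoc]
    _ = _ := by
        rw [Omega_mul_transpose, Matrix.one_mul, Matrix.mul_one, Matrix.fromBlocks_transpose,
          Matrix.transpose_zero, Matrix.transpose_zero]

lemma conjSO_mem_Hc {k : SO0 s} (hk : k ∈ Hc s) : conjSO h₁ h₂ k ∈ Hc s := by
  obtain ⟨A, hA, B, hB, hAB⟩ := hk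
  have hA1 : A * Aᵀ = 1 := (Matrix.mem_orthogonalGroup_iff _ _).1 hA.1
  have hB1 : B * Bᵀ = 1 := (Matrix.mem_orthogonalGroup_iff _ _).1 hB.1
  have key : ∀ {n : Type} [Fintype n] [DecidableEq n] {K A : Matrix n n ℝ}, K * Kᵀ = 1 →
      A * Aᵀ = 1 → K * A * Kᵀ * (K * A * Kᵀ)ᵀ = 1 := by
    intro n _ _ K A hK hA
    calc _ = K * (A * (Kᵀ * K) * Aᵀ) * Kᵀ := by
          simp only [Matrix.transpose_mul, Matrix.transpose_transpose, Matrix.mul_assoc]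
      _ = 1 := by rw [mul_eq_one_comm.1 hK, Matrix.mul_one, hA, Matrix.mul_one, hK]
  refine mem_Hc_of_fromBlocks (A := K₁ * A * K₁ᵀ) (D := K₂ * B * K₂ᵀ) ?_ (key h₁ hA1) (key h₂ hB1)
  rw [hatMat_conjSO, show hatMat k = _ from hAB, Matrix.fromBlocks_transpose,
    Matrix.fromBlocks_multiply, Matrix.fromBlocks_multiply]
  simp

lemma lengthSet_subset_of_conj (g : SO0 s) :
    lengthSet ((1 : SO0 s) : SymmSpace s) g ⊆ lengthSet ((1 : SO0 s) : SymmSpace s)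
      (conjSO h₁ h₂ g) := by
  have hcoset : ∀ {a b : SO0 s}, (a : SymmSpace s) = b →
      (conjSO h₁ h₂ a : SymmSpace s) = conjSO h₁ h₂ b := by
    intro a b hab
    rw [QuotientGroup.eq] at hab ⊢
    rw [← conjSO_inv, ← conjSO_mul]
    exact conjSO_mem_Hc h₁ h₂ hab
  rintro _ ⟨γ, hγ, h0, h1, rfl⟩
  have hr := blockRot_mul_transpose (s := s) h₁ h₂
  obtain ⟨hC, hL⟩ := hγ.curveLength_transform (δ := fun t => conjSO h₁ h₂ (γ t))
    (A := blockRot K₁ K₂) (A' := (blockRot K₁ K₂)ᵀ) (B := (blockRot K₁ K₂)ᵀ)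
    (mul_eq_one_comm.1 hr) (by rw [Matrix.transpose_transpose, mul_eq_one_comm.1 hr])
    (fun t => rfl)
  refine ⟨_, hC, ?_, hcoset h1, hL⟩
  rw [hcoset h0, conjSO_one]

lemma geodDist_conjSO (g : SO0 s) :
    geodDist ((1 : SO0 s) : SymmSpace s) (conjSO h₁ h₂ g) =
      geodDist ((1 : SO0 s) : SymmSpace s) g := by
  have h₁' : K₁ᵀ * K₁ᵀᵀ = 1 := by rw [Matrix.transpose_transpose, mul_eq_one_comm.1 h₁]
  have h₂' : K₂ᵀ * K₂ᵀᵀ = 1 := by rw [Matrix.transpose_transpose, mul_eq_one_comm.1 h₂]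
  have h := lengthSet_subset_of_conj h₁' h₂' (conjSO h₁ h₂ g)
  have hinv : conjSO h₁' h₂' (conjSO h₁ h₂ g) = g := by
    have hr := mul_eq_one_comm.1 (blockRot_mul_transpose (s := s) h₁ h₂)
    apply toMat_injective
    rw [toMat_conjSO, toMat_conjSO, ← blockRot_transpose, Matrix.transpose_transpose]
    calc _ = (blockRot K₁ K₂)ᵀ * blockRot K₁ K₂ * toMat g *
          ((blockRot K₁ K₂)ᵀ * blockRot K₁ K₂) := by simp only [Matrix.mul_assoc]
      _ = _ := by rw [hr, Matrix.one_mul, Matrix.mul_one]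
  rw [hinv] at h
  exact congrArg sInf (Subset.antisymm h (lengthSet_subset_of_conj h₁ h₂ g))

end Conj

/-! ### The Cartan decomposition -/

/-- A matrix with orthogonal columns of lengths `|σ i|` is an orthogonal matrix times a diagonal
one. -/
lemma exists_orthogonal_mul_eq {n m : Type*} [Fintype n] [Fintype m] [DecidableEq n]
    [DecidableEq m] {A : Matrix (n ⊕ m) m ℝ} {σ : m → ℝ}
    (h : Aᵀ * A = Matrix.diagonal fun i => σ i ^ 2) :
    ∃ Q : Matrix (n ⊕ m) (n ⊕ m) ℝ, Qᵀ * Q = 1 ∧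
      Q * (Matrix.fromRows 0 (Matrix.diagonal σ) : Matrix (n ⊕ m) m ℝ) = A := by
  have hA : ∀ i j, ∑ k, A k i * A k j = if i = j then σ i ^ 2 else 0 := fun i j => by
    have := congrFun (congrFun h i) j
    rwa [Matrix.mul_apply, Matrix.diagonal_apply] at this
  let v : n ⊕ m → EuclideanSpace ℝ (n ⊕ m) :=
    Sum.elim (fun _ => 0) fun j => WithLp.toLp 2 fun k => (σ j)⁻¹ * A k j
  let S : Set (n ⊕ m) := {i | ∃ j, i = .inr j ∧ σ j ≠ 0}
  have hv : Orthonormal ℝ (S.domRestrict v) := by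
    rw [orthonormal_iff_ite]
    rintro ⟨_, i, rfl, hi⟩ ⟨_, j, rfl, hj⟩
    have : inner ℝ (v (.inr i)) (v (.inr j)) = (σ i)⁻¹ * (σ j)⁻¹ * ∑ k, A k i * A k j := by
      rw [PiLp.inner_apply, Finset.mul_sum]
      refine Finset.sum_congr rfl fun k _ => ?_
      simp [v]
      ring
    simp only [Set.domRestrict_apply, this, hA, Subtype.mk.injEq, Sum.inr.injEq]
    split_ifs with hij
    · subst hij
      field_simp
    · simp
  obtain ⟨b, hb⟩ := hv.exists_orthonormalBasis_extension_of_card_eq (by simp)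
  refine ⟨Matrix.of fun i j => b j i, ?_, ?_⟩
  · ext i j
    have := orthonormal_iff_ite.1 b.orthonormal i j
    rw [PiLp.inner_apply] at this
    rw [Matrix.mul_apply, Matrix.one_apply, ← this]
    refine Finset.sum_congr rfl fun k _ => ?_
    simp [mul_comm]
  · ext i j
    rw [Matrix.mul_apply, Fintype.sum_sum_type]
    simp only [Matrix.fromRows_apply_inl, Matrix.fromRows_apply_inr, Matrix.zero_apply, mul_zero,
      Finset.sum_const_zero, zero_add, Matrix.of_apply, Matrix.diagonal_apply, mul_ite,
      Finset.sum_ite_eq', Finset.mem_univ, if_true]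
    by_cases hj : σ j = 0
    · have h0 := hA j j
      rw [if_pos rfl, hj] at h0
      have := (Finset.sum_eq_zero_iff_of_nonneg fun k _ => mul_self_nonneg (A k j)).1
        (h0.trans (by norm_num)) i (Finset.mem_univ i)
      rw [hj, mul_zero, mul_self_eq_zero.1 this]
    · rw [hb (.inr j) ⟨j, rfl, hj⟩]
      simp [v]
      field_simp

lemma hatMat_upper_gram (g : SO0 s) : ((hatMat g).toBlocks₂₂)ᵀ * (hatMat g).toBlocks₂₂ =
    1 + ((hatMat g).toBlocks₁₂)ᵀ * (hatMat g).toBlocks₁₂ := by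
  have h := hatMat_transpose_mul_etaB_mul g
  rw [← Matrix.fromBlocks_toBlocks (hatMat g), Matrix.fromBlocks_transpose] at h
  have h' := (fromBlocks_relations_of_etaB (A := ((hatMat g).toBlocks₁₁)ᵀ)
    (B := ((hatMat g).toBlocks₂₁)ᵀ) (C := ((hatMat g).toBlocks₁₂)ᵀ)
    (D := ((hatMat g).toBlocks₂₂)ᵀ)
    (by rw [Matrix.fromBlocks_transpose]; simpa only [Matrix.transpose_transpose] using h)).2.2
  simpa only [Matrix.transpose_transpose] using h'

lemma hatMat_flat (t : Fin 2 → ℝ) : hatMat (cosetRep (flatCoord s (t 0) (t 1))) =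
    Matrix.fromBlocks
      (Matrix.fromBlocks 1 0 0 (Matrix.diagonal fun i => Real.cosh (t i)))
      (Matrix.fromRows 0 (Matrix.diagonal fun i => Real.sinh (t i)))
      (Matrix.fromCols 0 (Matrix.diagonal fun i => Real.sinh (t i)))
      (Matrix.diagonal fun i => Real.cosh (t i)) := by
  have h2 := inv_sqrt_two_sq
  rw [hatMat, toMat_cosetRep, explicitL_flatCoord]
  ext ((i | i) | i) ((j | j) | j) <;> try fin_cases i
  all_goals try fin_cases j
  all_goals simp only [mul_Omega_transpose_apply, Omega_mul_apply_inr,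
      Omega_mul_apply_inl_inr, Omega_mul_apply_inl_inl, Matrix.transpose_apply]
  all_goals simp [flatVec, Matrix.diagonal_apply, Real.cosh_eq, Real.sinh_eq, Fin.rev,
    Matrix.one_apply, eq_comm]
  all_goals
    ring_nf
    simp only [h2]
    try ring

/-- Cartan decomposition: up to a conjugation, every point lies in the maximal flat. -/
theorem exists_conjSO_eq_flat (g : SO0 s) :
    ∃ (K₁ : Matrix (Fin (2 * s) ⊕ Fin 2) (Fin (2 * s) ⊕ Fin 2) ℝ) (K₂ : Matrix (Fin 2) (Fin 2) ℝ)
      (h₁ : K₁ * K₁ᵀ = 1) (h₂ : K₂ * K₂ᵀ = 1) (t : Fin 2 → ℝ),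
      (conjSO h₁ h₂ g : SymmSpace s) = cosetRep (flatCoord s (t 0) (t 1)) := by
  set B := (hatMat g).toBlocks₁₂ with hB
  set D := (hatMat g).toBlocks₂₂ with hD
  have hrel : Dᵀ * D = 1 + Bᵀ * B := hatMat_upper_gram g
  have hpsd : (Bᵀ * B).PosSemidef := Matrix.posSemidef_conjTranspose_mul_self B
  -- diagonalise `Bᵀ B` by an orthogonal matrix `P`
  obtain ⟨P, μ, hP, hμ, hdiag⟩ : ∃ (P : Matrix (Fin 2) (Fin 2) ℝ) (μ : Fin 2 → ℝ),
      Pᵀ * P = 1 ∧ (∀ i, 0 ≤ μ i) ∧ Pᵀ * (Bᵀ * B) * P = Matrix.diagonal μ := by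
    have hH := hpsd.isHermitian
    refine ⟨hH.eigenvectorUnitary, hH.eigenvalues, ?_, hpsd.eigenvalues_nonneg, ?_⟩
    · exact (Matrix.mem_orthogonalGroup_iff' _ _).1 hH.eigenvectorUnitary.2
    · have h := hH.conjStarAlgAut_star_eigenvectorUnitary
      rw [Unitary.conjStarAlgAut_star_apply] at h
      exact h
  have hP' : P * Pᵀ = 1 := mul_eq_one_comm.1 hP
  let t : Fin 2 → ℝ := fun i => Real.arsinh √(μ i)
  have hsinh : ∀ i, Real.sinh (t i) ^ 2 = μ i := fun i => by
    rw [Real.sinh_arsinh, Real.sq_sqrt (hμ i)]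
  have hcosh : ∀ i, Real.cosh (t i) * Real.cosh (t i) = 1 + μ i := fun i => by
    rw [← pow_two, Real.cosh_sq, hsinh, add_comm]
  obtain ⟨Q, hQ, hQB⟩ := exists_orthogonal_mul_eq (A := B * P) (σ := fun i => Real.sinh (t i)) (by
    simp only [hsinh]
    rw [← hdiag, Matrix.transpose_mul]
    simp only [Matrix.mul_assoc])
  set C : Matrix (Fin 2) (Fin 2) ℝ := Matrix.diagonal fun i => Real.cosh (t i) with hC
  set C' : Matrix (Fin 2) (Fin 2) ℝ := Matrix.diagonal fun i => (Real.cosh (t i))⁻¹ with hC'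
  have hCC : C' * C = 1 := by
    rw [hC, hC', Matrix.diagonal_mul_diagonal, ← Matrix.diagonal_one]
    congr 1; ext i
    exact inv_mul_cancel₀ (Real.cosh_pos _).ne'
  have hDP : (D * P)ᵀ * (D * P) = C * C := by
    calc _ = Pᵀ * (Dᵀ * D) * P := by rw [Matrix.transpose_mul]; simp only [Matrix.mul_assoc]
      _ = Pᵀ * P + Pᵀ * (Bᵀ * B) * P := by
          rw [hrel, Matrix.mul_add, Matrix.add_mul, Matrix.mul_one]
      _ = C * C := by
          rw [hP, hdiag, hC, Matrix.diagonal_mul_diagonal, ← Matrix.diagonal_one,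
            Matrix.diagonal_add]
          congr 1; ext i; exact (hcosh i).symm
  have hCC' : C * C' = 1 := mul_eq_one_comm.1 hCC
  have hC't : C'ᵀ = C' := Matrix.diagonal_transpose _
  set K₂ := (D * P * C')ᵀ with hK₂
  have hK₂t : K₂ᵀ * C = D * P := by
    rw [hK₂, Matrix.transpose_transpose, Matrix.mul_assoc, hCC, Matrix.mul_one]
  have h₂ : K₂ * K₂ᵀ = 1 := by
    rw [hK₂, Matrix.transpose_transpose, Matrix.transpose_mul, hC't]
    calc _ = C' * ((D * P)ᵀ * (D * P)) * C' := by simp only [Matrix.mul_assoc]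
      _ = (C' * C) * (C * C') := by rw [hDP]; simp only [Matrix.mul_assoc]
      _ = 1 := by rw [hCC, hCC', Matrix.mul_one]
  have h₁ : Qᵀ * Qᵀᵀ = 1 := by rw [Matrix.transpose_transpose, hQ]
  refine ⟨Qᵀ, K₂, h₁, h₂, t, Eq.symm (QuotientGroup.eq.2 (mem_Hc_of_upper_right_eq_zero ?_))⟩
  set a := cosetRep (flatCoord s (t 0) (t 1)) with ha
  -- the last two columns of the conjugate are those of the flat element, up to an orthogonal matrix
  have hcol : ∀ i j, hatMat (conjSO h₁ h₂ g) i (.inr j) =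
      ∑ k, hatMat a i (.inr k) * (Pᵀ * K₂ᵀ) k j := by
    have e12 : (hatMat (conjSO h₁ h₂ g)).toBlocks₁₂ = (hatMat a).toBlocks₁₂ * (Pᵀ * K₂ᵀ) := by
      rw [hatMat_conjSO, ← Matrix.fromBlocks_toBlocks (hatMat g), ← hB, ← hD,
        Matrix.fromBlocks_transpose, Matrix.fromBlocks_multiply, Matrix.fromBlocks_multiply,
        Matrix.toBlocks_fromBlocks₁₂, ha, hatMat_flat, Matrix.toBlocks_fromBlocks₁₂]
      have hB' : Qᵀ * B = (Matrix.fromRows 0 (Matrix.diagonal fun i => Real.sinh (t i)) :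
          Matrix (Fin (2 * s) ⊕ Fin 2) (Fin 2) ℝ) * Pᵀ := by
        calc Qᵀ * B = Qᵀ * (B * P) * Pᵀ := by
              rw [Matrix.mul_assoc, Matrix.mul_assoc, hP', Matrix.mul_one]
          _ = _ := by rw [← hQB, ← Matrix.mul_assoc, hQ, Matrix.one_mul]
      simp [hB', Matrix.mul_assoc]
    have e22 : (hatMat (conjSO h₁ h₂ g)).toBlocks₂₂ = (hatMat a).toBlocks₂₂ * (Pᵀ * K₂ᵀ) := by
      rw [hatMat_conjSO, ← Matrix.fromBlocks_toBlocks (hatMat g), ← hB, ← hD,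
        Matrix.fromBlocks_transpose, Matrix.fromBlocks_multiply, Matrix.fromBlocks_multiply,
        Matrix.toBlocks_fromBlocks₂₂, ha, hatMat_flat, Matrix.toBlocks_fromBlocks₂₂]
      have hD' : K₂ * D = C * Pᵀ := by
        calc K₂ * D = K₂ * (D * P) * Pᵀ := by
              rw [Matrix.mul_assoc, Matrix.mul_assoc, hP', Matrix.mul_one]
          _ = _ := by rw [← hK₂t, ← Matrix.mul_assoc, h₂, Matrix.one_mul]
      simp [hD', Matrix.mul_assoc, ← hC]
    rintro (i | i) j
    · exact congrFun (congrFun e12 i) j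
    · exact congrFun (congrFun e22 i) j
  have hinv : hatMat a⁻¹ * hatMat a = 1 := by rw [← hatMat_mul, inv_mul_cancel, hatMat_one]
  ext i j
  change hatMat (a⁻¹ * conjSO h₁ h₂ g) (.inl i) (.inr j) = 0
  rw [hatMat_mul, Matrix.mul_apply]
  simp only [hcol, Finset.mul_sum, ← mul_assoc]
  rw [Finset.sum_comm]
  simp only [← Finset.sum_mul, ← Matrix.mul_apply, hinv]
  simp

/-! ### Eigenvalues and the distance formula -/

lemma gramM_eq (W : SolvCoord s) :
    gramM W = (hatMat (cosetRep W) * (hatMat (cosetRep W))ᵀ).toBlocks₂₂ := rfl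

lemma lambdaMinus_le_lambdaPlus (W : SolvCoord s) : lambdaMinus W ≤ lambdaPlus W := by
  have := Real.sqrt_nonneg ((lastRow W 0 ⬝ᵥ lastRow W 0 - lastRow W 1 ⬝ᵥ lastRow W 1) ^ 2
      + 4 * (lastRow W 0 ⬝ᵥ lastRow W 1) ^ 2)
  rw [lambdaMinus, lambdaPlus]
  linarith

/-- The Gram matrix is orthogonally conjugate to `diag(cosh 2t₀, cosh 2t₁)`, where `(t₀, t₁)` are
the Cartan coordinates of the point in the maximal flat to which `𝕃(W)` is conjugate. -/
lemma exists_gramM_conj (W : SolvCoord s) : ∃ (K : Matrix (Fin 2) (Fin 2) ℝ) (t : Fin 2 → ℝ),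
    K * Kᵀ = 1 ∧ K * gramM W * Kᵀ = Matrix.diagonal (fun i => Real.cosh (2 * t i)) ∧
      sqNorm (cosetRep W) = 2 * (t 0 ^ 2 + t 1 ^ 2) := by
  obtain ⟨K₁, K₂, h₁, h₂, t, ht⟩ := exists_conjSO_eq_flat (cosetRep W)
  refine ⟨K₂, t, h₂, ?_, ?_⟩
  · set a := cosetRep (flatCoord s (t 0) (t 1)) with ha
    set g := cosetRep W with hg
    have e1 : toMat (conjSO h₁ h₂ g) * (toMat (conjSO h₁ h₂ g))ᵀ = toMat a * (toMat a)ᵀ := by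
      rw [toMat_gram_eq_explicitL (Y := flatCoord s (t 0) (t 1)) ht.symm, Matrix.mul_one, ha,
        toMat_cosetRep]
    have e2 : hatMat (conjSO h₁ h₂ g) * (hatMat (conjSO h₁ h₂ g))ᵀ = hatMat a * (hatMat a)ᵀ := by
      simp only [hatMat, Omega_conj_transpose, Omega_conj_mul, e1]
    have e3 : hatMat (conjSO h₁ h₂ g) * (hatMat (conjSO h₁ h₂ g))ᵀ =
        Matrix.fromBlocks K₁ 0 0 K₂ * (hatMat g * (hatMat g)ᵀ) *
          (Matrix.fromBlocks K₁ 0 0 K₂)ᵀ := by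
      have hK : (Matrix.fromBlocks K₁ 0 0 K₂)ᵀ * Matrix.fromBlocks K₁ 0 0 K₂ = 1 := by
        rw [Matrix.fromBlocks_transpose, Matrix.fromBlocks_multiply, mul_eq_one_comm.1 h₁,
          mul_eq_one_comm.1 h₂]
        simp
      rw [hatMat_conjSO]
      calc _ = Matrix.fromBlocks K₁ 0 0 K₂ * hatMat g *
            ((Matrix.fromBlocks K₁ 0 0 K₂)ᵀ * Matrix.fromBlocks K₁ 0 0 K₂) * (hatMat g)ᵀ *
            (Matrix.fromBlocks K₁ 0 0 K₂)ᵀ := by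
            simp only [Matrix.transpose_mul, Matrix.transpose_transpose, Matrix.mul_assoc]
        _ = _ := by rw [hK, Matrix.mul_one]; simp only [Matrix.mul_assoc]
    have e4 := congrArg Matrix.toBlocks₂₂ (e3.symm.trans e2)
    rw [← Matrix.fromBlocks_toBlocks (hatMat g * (hatMat g)ᵀ), ← gramM_eq,
      Matrix.fromBlocks_transpose, Matrix.fromBlocks_multiply, Matrix.fromBlocks_multiply,
      Matrix.toBlocks_fromBlocks₂₂, ha, hatMat_flat, Matrix.fromBlocks_transpose,
      Matrix.fromBlocks_multiply, Matrix.toBlocks_fromBlocks₂₂, Matrix.transpose_fromCols,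
      Matrix.fromCols_mul_fromRows] at e4
    simp only [Matrix.zero_mul, zero_add, Matrix.mul_zero, Matrix.transpose_zero,
      Matrix.diagonal_transpose, Matrix.diagonal_mul_diagonal, Matrix.diagonal_add] at e4
    rw [e4]
    congr 1
    ext i
    rw [Real.cosh_two_mul]
    ring
  · rw [sqNorm, ← geodDist_conjSO h₁ h₂, ht, geodDist_flat, Real.sq_sqrt (by positivity)]

lemma exists_lambda_eq_cosh (W : SolvCoord s) : ∃ t₀ t₁ : ℝ,
    lambdaPlus W = Real.cosh (2 * t₀) ∧ lambdaMinus W = Real.cosh (2 * t₁) ∧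
      sqNorm (cosetRep W) = 2 * (t₀ ^ 2 + t₁ ^ 2) := by
  obtain ⟨K, t, hK, hd, hn⟩ := exists_gramM_conj W
  have hK' : Kᵀ * K = 1 := mul_eq_one_comm.1 hK
  have htr : lambdaPlus W + lambdaMinus W = Real.cosh (2 * t 0) + Real.cosh (2 * t 1) := by
    have h := congrArg Matrix.trace hd
    rwa [Matrix.trace_mul_comm, ← Matrix.mul_assoc, hK', Matrix.one_mul, lambda_add,
      Matrix.trace_diagonal, Fin.sum_univ_two] at h
  have hdet : lambdaPlus W * lambdaMinus W = Real.cosh (2 * t 0) * Real.cosh (2 * t 1) := by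
    have h := congrArg Matrix.det hd
    rwa [Matrix.det_conj_of_mul_eq_one hK hK', lambda_mul, Matrix.det_diagonal,
      Fin.prod_univ_two] at h
  have hroot : (lambdaPlus W - Real.cosh (2 * t 0)) * (lambdaPlus W - Real.cosh (2 * t 1)) = 0 := by
    linear_combination lambdaPlus W * htr - hdet
  rcases mul_eq_zero.1 hroot with h | h
  · exact ⟨t 0, t 1, by linarith, by linarith, hn⟩
  · exact ⟨t 1, t 0, by linarith, by linarith, by rw [hn, add_comm]⟩

lemma one_le_lambdaMinus (W : SolvCoord s) : 1 ≤ lambdaMinus W := by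
  obtain ⟨t₀, t₁, -, h, -⟩ := exists_lambda_eq_cosh W
  rw [h]; exact Real.one_le_cosh _

lemma arcosh_cosh_sq (x : ℝ) : Real.arcosh (Real.cosh x) ^ 2 = x ^ 2 := by
  rw [← Real.cosh_abs, Real.arcosh_cosh (abs_nonneg x), sq_abs]

theorem sqNorm_cosetRep (W : SolvCoord s) : sqNorm (cosetRep W) =
    1 / 2 * (Real.arcosh (lambdaPlus W) ^ 2 + Real.arcosh (lambdaMinus W) ^ 2) := by
  obtain ⟨t₀, t₁, h0, h1, hn⟩ := exists_lambda_eq_cosh W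
  rw [h0, h1, hn, arcosh_cosh_sq, arcosh_cosh_sq]
  ring

/-! ### The paint invariants -/

lemma lambdaPlus_eq_inv (W : SolvCoord s) : lambdaPlus W =
    1 / 2 * (invA W.x1 W.x2 W.x3 W.x4 (W.x5 ⬝ᵥ W.x5) (W.x6 ⬝ᵥ W.x6) (W.x5 ⬝ᵥ W.x6)
      + √(invB W.x1 W.x2 W.x3 W.x4 (W.x5 ⬝ᵥ W.x5) (W.x6 ⬝ᵥ W.x6) (W.x5 ⬝ᵥ W.x6))) := by
  rw [← lastRow_sum_eq_invA, ← lastRow_disc_eq_invB, lambdaPlus]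

lemma lambdaMinus_eq_inv (W : SolvCoord s) : lambdaMinus W =
    1 / 2 * (invA W.x1 W.x2 W.x3 W.x4 (W.x5 ⬝ᵥ W.x5) (W.x6 ⬝ᵥ W.x6) (W.x5 ⬝ᵥ W.x6)
      - √(invB W.x1 W.x2 W.x3 W.x4 (W.x5 ⬝ᵥ W.x5) (W.x6 ⬝ᵥ W.x6) (W.x5 ⬝ᵥ W.x6))) := by
  rw [← lastRow_sum_eq_invA, ← lastRow_disc_eq_invB, lambdaMinus]

lemma sqNorm_eq_sqNormFormula (W : SolvCoord s) : sqNorm (cosetRep W) =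
    sqNormFormula W.x1 W.x2 W.x3 W.x4 (W.x5 ⬝ᵥ W.x5) (W.x6 ⬝ᵥ W.x6) (W.x5 ⬝ᵥ W.x6) := by
  rw [sqNorm_cosetRep, lambdaPlus_eq_inv, lambdaMinus_eq_inv, sqNormFormula]
  ring

lemma paint_dotProduct (R : Matrix.specialOrthogonalGroup (Fin (2 * s)) ℝ)
    (x y : Fin (2 * s) → ℝ) : (R.1 *ᵥ x) ⬝ᵥ (R.1 *ᵥ y) = x ⬝ᵥ y := by
  have hR : (R.1)ᵀ * R.1 = 1 := (Matrix.mem_orthogonalGroup_iff' _ _).1 R.2.1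
  rw [Matrix.dotProduct_mulVec, ← Matrix.mulVec_transpose, Matrix.mulVec_mulVec, hR,
    Matrix.one_mulVec]

lemma sqNorm_paint (R : Matrix.specialOrthogonalGroup (Fin (2 * s)) ℝ) (W : SolvCoord s) :
    sqNorm (cosetRep (paint R W)) = sqNorm (cosetRep W) := by
  rw [sqNorm_eq_sqNormFormula, sqNorm_eq_sqNormFormula]
  simp only [paint, paint_dotProduct]

lemma quotCoord_paint (R : Matrix.specialOrthogonalGroup (Fin (2 * s)) ℝ) (U V : SolvCoord s) :
    quotCoord (paint R U) (paint R V) = paint R (quotCoord U V) := by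
  ext1 <;> simp only [quotCoord, paint, paint_dotProduct, Matrix.mulVec_add, Matrix.mulVec_sub,
    Matrix.mulVec_smul]

lemma geodDist_nonneg (p q : SymmSpace s) : 0 ≤ geodDist p q := by
  refine Real.sInf_nonneg ?_
  rintro _ ⟨γ, -, -, -, rfl⟩
  exact intervalIntegral.integral_nonneg zero_le_one fun _ _ => Real.sqrt_nonneg _

lemma geodDist_paint (R : Matrix.specialOrthogonalGroup (Fin (2 * s)) ℝ) (U V : SolvCoord s) :
    geodDist (point (paint R U)) (point (paint R V)) = geodDist (point U) (point V) := by
  rw [← sq_eq_sq₀ (geodDist_nonneg _ _) (geodDist_nonneg _ _), geodDist_point_sq,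
    geodDist_point_sq, quotCoord_paint, sqNorm_paint]

end PaintDistance

end

open PaintDistance in
theorem mainTheorem3 (s : ℕ) (hs : 1 ≤ s) :
    -- the solvable coordinates are global coordinates of the symmetric space
    Function.Bijective (point : SolvCoord s → SymmSpace s) ∧
    -- explicit form of the coset representative
    (∀ Y : SolvCoord s, toMat (cosetRep Y) = explicitL Y) ∧
    -- explicit product law
    (∀ U V : SolvCoord s, (cosetRep U)⁻¹ * cosetRep V = cosetRep (quotCoord U V)) ∧
    -- the distance is the norm of `u⁻¹ · v`
    (∀ U V : SolvCoord s,
      geodDist (point U) (point V) ^ 2 = sqNorm (cosetRep (quotCoord U V))) ∧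
    -- explicit form of the vectors `𝓛⁽¹⁾`, `𝓛⁽²⁾`
    (∀ W : SolvCoord s, lastRow W 0 = explicitRow1 W ∧ lastRow W 1 = explicitRow2 W) ∧
    -- the lower right block of `M` is their Gram matrix, with eigenvalues `Λ₊ ≥ Λ₋ ≥ 1`
    (∀ W : SolvCoord s, (harmonicM W).toBlocks₂₂ = gramM W ∧
      (gramM W).charpoly = (Polynomial.X - Polynomial.C (lambdaPlus W)) *
        (Polynomial.X - Polynomial.C (lambdaMinus W)) ∧
      1 ≤ lambdaMinus W ∧ lambdaMinus W ≤ lambdaPlus W) ∧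
    -- the squared distance through the two eigenvalues
    (∀ U V : SolvCoord s, geodDist (point U) (point V) ^ 2 =
      1 / 2 * (Real.arcosh (lambdaPlus (quotCoord U V)) ^ 2
        + Real.arcosh (lambdaMinus (quotCoord U V)) ^ 2)) ∧
    -- the eigenvalues and the squared norm through the seven paint invariants
    (∀ W : SolvCoord s,
      0 ≤ invB W.x1 W.x2 W.x3 W.x4 (W.x5 ⬝ᵥ W.x5) (W.x6 ⬝ᵥ W.x6) (W.x5 ⬝ᵥ W.x6) ∧
      lambdaPlus W =
        1 / 2 * (invA W.x1 W.x2 W.x3 W.x4 (W.x5 ⬝ᵥ W.x5) (W.x6 ⬝ᵥ W.x6) (W.x5 ⬝ᵥ W.x6)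
          + √(invB W.x1 W.x2 W.x3 W.x4 (W.x5 ⬝ᵥ W.x5) (W.x6 ⬝ᵥ W.x6) (W.x5 ⬝ᵥ W.x6))) ∧
      lambdaMinus W =
        1 / 2 * (invA W.x1 W.x2 W.x3 W.x4 (W.x5 ⬝ᵥ W.x5) (W.x6 ⬝ᵥ W.x6) (W.x5 ⬝ᵥ W.x6)
          - √(invB W.x1 W.x2 W.x3 W.x4 (W.x5 ⬝ᵥ W.x5) (W.x6 ⬝ᵥ W.x6) (W.x5 ⬝ᵥ W.x6))) ∧
      sqNorm (cosetRep W) =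
        sqNormFormula W.x1 W.x2 W.x3 W.x4 (W.x5 ⬝ᵥ W.x5) (W.x6 ⬝ᵥ W.x6) (W.x5 ⬝ᵥ W.x6)) ∧
    -- the seven arguments are invariant under the paint group `SO(2s)`, and so are the squared
    -- norm and the distance
    (∀ (R : Matrix.specialOrthogonalGroup (Fin (2 * s)) ℝ) (W : SolvCoord s),
      ((paint R W).x1 = W.x1 ∧ (paint R W).x2 = W.x2 ∧ (paint R W).x3 = W.x3 ∧
        (paint R W).x4 = W.x4 ∧ (paint R W).x5 ⬝ᵥ (paint R W).x5 = W.x5 ⬝ᵥ W.x5 ∧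
        (paint R W).x6 ⬝ᵥ (paint R W).x6 = W.x6 ⬝ᵥ W.x6 ∧
        (paint R W).x5 ⬝ᵥ (paint R W).x6 = W.x5 ⬝ᵥ W.x6) ∧
      sqNorm (cosetRep (paint R W)) = sqNorm (cosetRep W)) ∧
    (∀ (R : Matrix.specialOrthogonalGroup (Fin (2 * s)) ℝ) (U V : SolvCoord s),
      geodDist (point (paint R U)) (point (paint R V)) = geodDist (point U) (point V)) :=
  ⟨point_bijective, toMat_cosetRep, inv_cosetRep_mul_cosetRep, geodDist_point_sq,
    fun W => ⟨lastRow_zero W, lastRow_one W⟩,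
    fun W => ⟨harmonicM_toBlocks W, gramM_charpoly W, one_le_lambdaMinus W,
      lambdaMinus_le_lambdaPlus W⟩,
    fun U V => by rw [geodDist_point_sq, sqNorm_cosetRep],
    fun W => ⟨by rw [← lastRow_disc_eq_invB]; positivity, lambdaPlus_eq_inv W,
      lambdaMinus_eq_inv W, sqNorm_eq_sqNormFormula W⟩,
    fun R W => ⟨⟨rfl, rfl, rfl, rfl, paint_dotProduct R _ _, paint_dotProduct R _ _,
      paint_dotProduct R _ _⟩, sqNorm_paint R W⟩,
    geodDist_paint⟩
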